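/- **Partial monitoring.** Let $\mathcal G=(\mathcal L,\Phi)$ be a partial monitoring game with loss matrix $\mathcal L\in[0,1]^{k\times d}$ and feedback matrix $\Phi\in\Sigma^{k\times d}$, $\Sigma$ finite. Let $\mathcal P_n$ be the probability simplex in $\mathbb R^n$ and $\mathcal C_a=\{v\in\mathcal P_d:\sum_x(\mathcal L_{ax}-\mathcal L_{bx})v_x\le 0\ \forall b\}$ the cell of action $a$. Assume that no two actions have the same row of $\mathcal L$ and that all actions are Pareto optimal ($\dim\mathcal C_a=d-1$). Distinct actions $a,b$ are neighbors if $\dim(\mathcal C_a\cap\mathcal C_b)=d-2$. Assume that $\mathcal G$ is globally observable: for all neighbors $a,b$ there is $w_{(a,b)}:[k]\times\Sigma\to\mathbb R$ with $\sum_{c}w_{(a,b)}(c,\Phi_{cx})=\mathcal L_{ax}-\mathcal L_{bx}$ for all $x\in[d]$. Fix any such functions, and any in-tree on $[k]$ with arbitrary root whose edges (directed towards the root) join neighbors. Let $G(a,\sigma)_b=\sum_e w_e(a,\sigma)$, summed over the edges $e$ on the path from $b$ to the root, and $c_{\mathcal G}=\max\{1,k\|G\|_\infty\}$ with $\|G\|_\infty=\max_{a,\sigma,b}|G(a,\sigma)_b|$.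 **Algorithm.** Let $\alpha\in(0,1)$, $\bar\alpha=1-\alpha$, $H_\alpha(p)=\frac1\alpha\sum_{i}(p_i^\alpha-p_i)$, $\beta_1\ge\frac{64c_{\mathcal G}^2}{1-\alpha}$ and $\bar\beta=\frac{32c_{\mathcal G}\sqrt k}{(1-\alpha)^2\sqrt{\beta_1}}$. In round $t=1,2,\dots$ the environment picks an outcome $x_t\in[d]$ (possibly at random and depending on the past), and the learner computes $$q_t=\arg\min_{p\in\mathcal P_k}\Big\{\sum_{s<t}\langle\hat\ell_s,p\rangle-\beta_tH_\alpha(p)-\bar\beta H_{\bar\alpha}(p)\Big\},\qquad h_t=H_\alpha(q_t),$$ and, with $\tilde I_t\in\arg\max_iq_{ti}$ and $q_{t*}=\min\{q_{t\tilde I_t},1-q_{t\tilde I_t}\}$, $$z_t=\tfrac{4c_{\mathcal G}^2}{1-\alpha}\Big(\sum_{i\ne\tilde I_t}q_{ti}^{2-\alpha}+q_{t*}^{2-\alpha}\Big),\quad u_t=\tfrac{8c_{\mathcal G}}{1-\alpha}q_{t*}^{1-\alpha},\quad \gamma'_t=\sqrt{z_t/\beta_t},\quad \gamma_t=\gamma'_t+u_t/\beta_t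 .$$ It draws $A_t$ from $p_t=(1-\gamma_t)q_t+\gamma_t\mathbf 1/k$, observes only $\sigma_t=\Phi_{A_tx_t}$, and sets $\hat\ell_t=G(A_t,\sigma_t)/p_{tA_t}\in\mathbb R^k$ and $\beta_{t+1}=\beta_t+\frac1{h_t}\big(2\sqrt{z_t/\beta_t}+u_t/\beta_t\big)$ (with $\beta_{t+1}=\beta_t$ in the trivial case $k=1$, where $h_t=z_t=u_t=0$). **Claim.** There are absolute constants $C,c_1,c_2>0$ such that for every such game, choice of $w$ and in-tree, and every $\alpha\in(0,1)$, there are $\rho_1,\rho_2>0$ with $$c_1\frac{c_{\mathcal G}^2k^{1-\alpha}}{\alpha(1-\alpha)}\le\rho_1\le c_2\frac{c_{\mathcal G}^2k^{1-\alpha}}{\alpha(1-\alpha)},\qquad c_1\frac{c_{\mathcal G}k^{1-\alpha}}{\alpha(1-\alpha)}\le\rho_2\le c_2\frac{c_{\mathcal G}k^{1-\alpha}}{\alpha(1-\alpha)},$$ such that for every admissible $\beta_1$, every environment, every horizon $T$ and every $a^*\in\arg\min_a\mathbb E[\sum_{t\le T}\mathcal L_{ax_t}]$ the algorithm satisfies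 all the assumptions of the best-of-both-worlds regret bound: $\gamma_t\in[0,1/2]$, $p_t\in\mathcal P_k$ and $z_t,u_t\ge0$ for all $t\in[T]$; and, with $\mathsf{Reg}_T=\mathbb E[\sum_{t\le T}(\mathcal L_{A_tx_t}-\mathcal L_{a^*x_t})]$, $\mathbb E_t$ the expectation given the actions and observations before round $t$, $D$ the Bregman divergence (all expectations being of integrable variables) and the convention $0/0=0$, (i) $\mathsf{Reg}_T\le\mathbb E\big[\sum_{t=1}^T\langle\hat\ell_t,q_t-e_{a^*}\rangle+2\sum_{t=1}^T\gamma_t\big]$; (ii) $\mathbb E_t\big[\langle\hat\ell_t,q_t-q_{t+1}\rangle-\beta_tD_{(-H_\alpha)}(q_{t+1},q_t)\big]\le C\,\frac{z_t}{\beta_t\gamma'_t}$ almost surely, for all $t\in[T]$; (iii) $h_{t+1}\le C\,h_t$ for all $t\in[T]$; (iv) $\sqrt{z_th_t}\le\sqrt{\rho_1}\,(1-q_{ta^*})$ and $u_th_t\le\rho_2\,(1-q_{ta^*})$ for all $t\in[T]$. -/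

import Mathlib

open MeasureTheory

universe u v

noncomputable section

/-! ### Tsallis entropy and Bregman divergence -/

/-- The `α`-Tsallis entropy `H_α(p) = α⁻¹ ∑ᵢ (pᵢ ^ α - pᵢ)`. -/
def tsallis {k : ℕ} (α : ℝ) (p : Fin k → ℝ) : ℝ :=
  (1 / α) * ∑ i, (p i ^ α - p i)

/-- The Bregman divergence `D_ψ(x, y) = ψ(x) - ψ(y) - ⟨∇ψ(y), x - y⟩`. -/
def bregman {k : ℕ} (ψ : (Fin k → ℝ) → ℝ) (x y : Fin k → ℝ) : ℝ :=
  ψ x - ψ y - fderiv ℝ ψ y (x - y)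

/-! ### FTRL with Tsallis entropy, forced exploration and the stability-penalty-bias
matching learning rate -/

/-- The inputs of the algorithm with `k` actions and observations in `O`: the exponent `α`, the
initial learning-rate parameter `β₁`, the constant `βbar`, the exploration distribution `p₀`, the
components `z_t = z q_t` and `u_t = u q_t`, and the loss estimator `est p a o`, computed from the
sampling distribution `p`, the chosen action `a` and the observation `o`. -/
structure SPB (k : ℕ) (O : Type u) where
  α : ℝ
  β₁ : ℝ
  βbar : ℝ
  p₀ : Fin k → ℝ
  z : (Fin k → ℝ) → ℝ
  u : (Fin k → ℝ) → ℝ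
  est : (Fin k → ℝ) → Fin k → O → Fin k → ℝ

namespace SPB

variable {k : ℕ} {O : Type u}

/-- The FTRL objective `⟨L, p⟩ + β (-H_α(p)) + βbar (-H_{1-α}(p))`. -/
def objective (alg : SPB k O) (L : Fin k → ℝ) (β : ℝ) (p : Fin k → ℝ) : ℝ :=
  ∑ i, L i * p i + β * (-tsallis alg.α p) + alg.βbar * (-tsallis (1 - alg.α) p)

/-- A minimizer of the FTRL objective over the probability simplex. -/
def ftrl (alg : SPB k O) (L : Fin k → ℝ) (β : ℝ) : Fin k → ℝ :=
  Classical.epsilon fun p =>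
    p ∈ stdSimplex ℝ (Fin k) ∧ IsMinOn (alg.objective L β) (stdSimplex ℝ (Fin k)) p

/-- The minimizer exists, so that `ftrl` is what its name says. -/
theorem ftrl_spec [NeZero k] (alg : SPB k O) (hα : alg.α ∈ Set.Ioo (0 : ℝ) 1)
    (L : Fin k → ℝ) (β : ℝ) :
    alg.ftrl L β ∈ stdSimplex ℝ (Fin k) ∧
      IsMinOn (alg.objective L β) (stdSimplex ℝ (Fin k)) (alg.ftrl L β) := by
  have hc : Continuous (alg.objective L β) := by
    have h1 : ∀ i : Fin k, Continuous fun p : Fin k → ℝ => p i ^ alg.α := fun i =>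
      (continuous_apply i).rpow_const fun _ => Or.inr hα.1.le
    have h2 : ∀ i : Fin k, Continuous fun p : Fin k → ℝ => p i ^ (1 - alg.α) := fun i =>
      (continuous_apply i).rpow_const fun _ => Or.inr (by linarith [hα.2])
    unfold objective tsallis
    fun_prop
  have hne : (stdSimplex ℝ (Fin k)).Nonempty := ⟨_, single_mem_stdSimplex ℝ (0 : Fin k)⟩
  obtain ⟨p, hp, hmin⟩ := (isCompact_stdSimplex ℝ (Fin k)).exists_isMinOn hne hc.continuousOn
  exact Classical.epsilon_spec
    (p := fun p => p ∈ stdSimplex ℝ (Fin k) ∧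
      IsMinOn (alg.objective L β) (stdSimplex ℝ (Fin k)) p) ⟨p, hp, hmin⟩

/-- `γ' = √(z / β)`. -/
def rate' (alg : SPB k O) (q : Fin k → ℝ) (β : ℝ) : ℝ := √(alg.z q / β)

/-- `γ = γ' + u / β`. -/
def rate (alg : SPB k O) (q : Fin k → ℝ) (β : ℝ) : ℝ := alg.rate' q β + alg.u q / β

/-- `(1 - γ) q + γ p₀`. -/
def mix (alg : SPB k O) (q : Fin k → ℝ) (β : ℝ) : Fin k → ℝ :=
  fun i => (1 - alg.rate q β) * q i + alg.rate q β * alg.p₀ i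

/-- The internal state of the algorithm at the beginning of a round, i.e. the cumulative estimated
loss and the current learning-rate parameter, along a sequence `tr` of actions and observations.
Rounds are numbered from `0`, and `state tr t` depends on `tr 0, …, tr (t - 1)` only. -/
def state (alg : SPB k O) (tr : ℕ → Fin k × O) : ℕ → (Fin k → ℝ) × ℝ
  | 0 => (0, alg.β₁)
  | t + 1 =>
    let L := (alg.state tr t).1
    let β := (alg.state tr t).2
    let q := alg.ftrl L β
    (L + alg.est (alg.mix q β) (tr t).1 (tr t).2,
      β + 1 / tsallis alg.α q * (2 * √(alg.z q / β) + alg.u q / β))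

/-- The learning-rate parameter `β_t`. -/
def β (alg : SPB k O) (tr : ℕ → Fin k × O) (t : ℕ) : ℝ := (alg.state tr t).2

/-- The FTRL output `q_t`. -/
def q (alg : SPB k O) (tr : ℕ → Fin k × O) (t : ℕ) : Fin k → ℝ :=
  alg.ftrl (alg.state tr t).1 (alg.state tr t).2

/-- The penalty component `h_t = H_α(q_t)`. -/
def h (alg : SPB k O) (tr : ℕ → Fin k × O) (t : ℕ) : ℝ := tsallis alg.α (alg.q tr t)

/-- `γ'_t`. -/
def γ' (alg : SPB k O) (tr : ℕ → Fin k × O) (t : ℕ) : ℝ := alg.rate' (alg.q tr t) (alg.β tr t)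

/-- The exploration rate `γ_t`. -/
def γ (alg : SPB k O) (tr : ℕ → Fin k × O) (t : ℕ) : ℝ := alg.rate (alg.q tr t) (alg.β tr t)

/-- The action selection probability `p_t`. -/
def p (alg : SPB k O) (tr : ℕ → Fin k × O) (t : ℕ) : Fin k → ℝ := alg.mix (alg.q tr t) (alg.β tr t)

/-- The loss estimate of round `t`. -/
def lossEst (alg : SPB k O) (tr : ℕ → Fin k × O) (t : ℕ) : Fin k → ℝ :=
  alg.est (alg.p tr t) (tr t).1 (tr t).2

end SPB

/-! ### The general online learning framework -/

section OnlineLearning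

variable {Ω : Type v} {k : ℕ} {O : Type u}

/-- The sequence of actions and observations. -/
def trajectory (A : ℕ → Ω → Fin k) (o : ℕ → Ω → O) (ω : Ω) : ℕ → Fin k × O :=
  fun t => (A t ω, o t ω)

/-- The `σ`-algebra generated by the actions and observations before round `t`. -/
abbrev obsSigma (A : ℕ → Ω → Fin k) (o : ℕ → Ω → O) (t : ℕ) : MeasurableSpace Ω :=
  ⨆ s ∈ Finset.range t, MeasurableSpace.comap (fun ω => trajectory A o ω s) ⊤

variable [MeasurableSpace Ω]

/-- `a` minimizes the expected cumulative loss over the first `T` rounds. -/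
def IsOptimalAction (μ : Measure Ω) (ℓ : ℕ → Ω → Fin k → ℝ) (T : ℕ) (a : Fin k) : Prop :=
  ∀ b, ∫ ω, ∑ t ∈ Finset.range T, ℓ t ω a ∂μ ≤ ∫ ω, ∑ t ∈ Finset.range T, ℓ t ω b ∂μ

/-- The (pseudo-)regret against the action `a` over the first `T` rounds. -/
def regret (μ : Measure Ω) (ℓ : ℕ → Ω → Fin k → ℝ) (A : ℕ → Ω → Fin k) (T : ℕ) (a : Fin k) : ℝ :=
  ∫ ω, (∑ t ∈ Finset.range T, ℓ t ω (A t ω) - ∑ t ∈ Finset.range T, ℓ t ω a) ∂μ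

/-- The assumptions of the best-of-both-worlds regret bound for the algorithm `alg`, run for `T`
rounds with optimal action `astar`, where `C` is the constant hidden in `≲`. -/
structure BOBWAssumptions (alg : SPB k O) (μ : Measure Ω) (ℓ : ℕ → Ω → Fin k → ℝ)
    (A : ℕ → Ω → Fin k) (o : ℕ → Ω → O) (T : ℕ) (astar : Fin k) (C ρ₁ ρ₂ : ℝ) : Prop where
  loss_le : ∀ t < T, ∀ ω a, |ℓ t ω a| ≤ 1
  z_nonneg : ∀ t < T, ∀ ω, 0 ≤ alg.z (alg.q (trajectory A o ω) t)
  u_nonneg : ∀ t < T, ∀ ω, 0 ≤ alg.u (alg.q (trajectory A o ω) t)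
  rate_mem : ∀ t < T, ∀ ω, alg.γ (trajectory A o ω) t ∈ Set.Icc (0 : ℝ) (1 / 2)
  p_mem : ∀ t < T, ∀ ω, alg.p (trajectory A o ω) t ∈ stdSimplex ℝ (Fin k)
  /-- the function whose expectation bounds the regret is integrable -/
  regret_integrable : Integrable (fun ω =>
    ∑ t ∈ Finset.range T, ∑ i, alg.lossEst (trajectory A o ω) t i *
        (alg.q (trajectory A o ω) t i - (Pi.single astar 1 : Fin k → ℝ) i)
      + 2 * ∑ t ∈ Finset.range T, alg.γ (trajectory A o ω) t) μ
  /-- `Reg_T ≤ E[∑ ⟨ℓ̂_t, q_t - e_{a*}⟩ + 2 ∑ γ_t]` -/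
  regret_le : regret μ ℓ A T astar ≤ ∫ ω,
    (∑ t ∈ Finset.range T, ∑ i, alg.lossEst (trajectory A o ω) t i *
        (alg.q (trajectory A o ω) t i - (Pi.single astar 1 : Fin k → ℝ) i)
      + 2 * ∑ t ∈ Finset.range T, alg.γ (trajectory A o ω) t) ∂μ
  /-- the function in the stability condition is integrable -/
  stability_integrable : ∀ t < T, Integrable (fun ω =>
    ∑ i, alg.lossEst (trajectory A o ω) t i *
        (alg.q (trajectory A o ω) t i - alg.q (trajectory A o ω) (t + 1) i)
      - alg.β (trajectory A o ω) t * bregman (fun p => -tsallis alg.α p)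
          (alg.q (trajectory A o ω) (t + 1)) (alg.q (trajectory A o ω) t)) μ
  /-- `E_t[⟨ℓ̂_t, q_t - q_{t+1}⟩ - β_t D_{-H_α}(q_{t+1}, q_t)] ≲ z_t / (β_t γ'_t)` -/
  stability : ∀ t < T, μ[fun ω =>
    ∑ i, alg.lossEst (trajectory A o ω) t i *
        (alg.q (trajectory A o ω) t i - alg.q (trajectory A o ω) (t + 1) i)
      - alg.β (trajectory A o ω) t * bregman (fun p => -tsallis alg.α p)
          (alg.q (trajectory A o ω) (t + 1)) (alg.q (trajectory A o ω) t) | obsSigma A o t]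
    ≤ᵐ[μ] fun ω => C * (alg.z (alg.q (trajectory A o ω) t) /
        (alg.β (trajectory A o ω) t * alg.γ' (trajectory A o ω) t))
  /-- `h_{t+1} ≲ h_t` -/
  penalty : ∀ t < T, ∀ ω, alg.h (trajectory A o ω) (t + 1) ≤ C * alg.h (trajectory A o ω) t
  /-- `√(z_t h_t) ≤ √ρ₁ (1 - q_{t a*})` -/
  z_mul_h_le : ∀ t < T, ∀ ω,
    √(alg.z (alg.q (trajectory A o ω) t) * alg.h (trajectory A o ω) t) ≤
      √ρ₁ * (1 - alg.q (trajectory A o ω) t astar)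
  /-- `u_t h_t ≤ ρ₂ (1 - q_{t a*})` -/
  u_mul_h_le : ∀ t < T, ∀ ω,
    alg.u (alg.q (trajectory A o ω) t) * alg.h (trajectory A o ω) t ≤
      ρ₂ * (1 - alg.q (trajectory A o ω) t astar)

end OnlineLearning

/-! ### Partial monitoring -/

/-- The dimension of (the affine hull of) a set, with value `-1` for the empty set. -/
def affDim {d : ℕ} (s : Set (Fin d → ℝ)) : ℤ :=
  open Classical in if s.Nonempty then (Module.finrank ℝ (vectorSpan ℝ s) : ℤ) else -1

/-- A partial monitoring game with `k` actions, `d` outcomes and feedback symbols in `S`. -/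
structure PMGame (k d : ℕ) (S : Type u) where
  /-- the loss matrix -/
  loss : Fin k → Fin d → ℝ
  loss_mem : ∀ a x, loss a x ∈ Set.Icc (0 : ℝ) 1
  /-- the feedback matrix -/
  feedback : Fin k → Fin d → S

namespace PMGame

variable {k d : ℕ} {S : Type u}

/-- The cell of an action: the outcome distributions for which it is optimal. -/
def cell (𝒢 : PMGame k d S) (a : Fin k) : Set (Fin d → ℝ) :=
  {v | v ∈ stdSimplex ℝ (Fin d) ∧ ∀ b, ∑ x, (𝒢.loss a x - 𝒢.loss b x) * v x ≤ 0}

/-- An action is Pareto optimal if its cell has dimension `d - 1`. -/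
def ParetoOptimal (𝒢 : PMGame k d S) (a : Fin k) : Prop :=
  affDim (𝒢.cell a) = (d : ℤ) - 1

/-- Two distinct actions are neighbors if their cells meet in dimension `d - 2`. -/
def Neighbors (𝒢 : PMGame k d S) (a b : Fin k) : Prop :=
  a ≠ b ∧ affDim (𝒢.cell a ∩ 𝒢.cell b) = (d : ℤ) - 2

/-- The function `w` on actions and feedback symbols recovers the loss difference of `a` and
`b`. -/
def EstimatesDiff (𝒢 : PMGame k d S) (a b : Fin k) (w : Fin k → S → ℝ) : Prop :=
  ∀ x, ∑ c, w c (𝒢.feedback c x) = 𝒢.loss a x - 𝒢.loss b x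

/-- The game is globally observable. -/
def GloballyObservable (𝒢 : PMGame k d S) : Prop :=
  ∀ a b, 𝒢.Neighbors a b → ∃ w : Fin k → S → ℝ, 𝒢.EstimatesDiff a b w

/-- An in-tree on the set of actions whose edges `(a, parent a)`, `a ≠ root`, join neighbors. -/
structure InTree (𝒢 : PMGame k d S) where
  root : Fin k
  parent : Fin k → Fin k
  parent_root : parent root = root
  neighbors : ∀ a, a ≠ root → 𝒢.Neighbors a (parent a)
  reaches_root : ∀ a, ∃ n : ℕ, parent^[n] a = root

/-- The number of edges on the path from `b` to the root. -/
def InTree.depth {𝒢 : PMGame k d S} (𝒯 : 𝒢.InTree) (b : Fin k) : ℕ :=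
  Nat.find (𝒯.reaches_root b)

/-- `G(a, σ)_b`, the sum of `w_e(a, σ)` over the edges `e` on the path from `b` to the root, where
`w a' b'` is the function attached to the edge from `a'` to `b'`. -/
def pathSum {𝒢 : PMGame k d S} (𝒯 : 𝒢.InTree) (w : Fin k → Fin k → Fin k → S → ℝ) :
    Fin k → S → Fin k → ℝ :=
  fun a σ b => ∑ i ∈ Finset.range (𝒯.depth b),
    w (𝒯.parent^[i] b) (𝒯.parent^[i + 1] b) a σ

/-- `c_𝒢 = max {1, k ‖G‖_∞}`, with the maximum norm of `G` over all of its entries. -/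
def gameConst [Fintype S] (G : Fin k → S → Fin k → ℝ) : ℝ :=
  max 1 ((k : ℝ) * ‖G‖)

/-- `q_*`, where `I` selects a maximal entry. -/
def qStar (I : (Fin k → ℝ) → Fin k) (q : Fin k → ℝ) : ℝ :=
  min (q (I q)) (1 - q (I q))

/-- The algorithm for globally observable partial monitoring. -/
def pmAlg [Fintype S] (G : Fin k → S → Fin k → ℝ) (I : (Fin k → ℝ) → Fin k) (α β₁ : ℝ) :
    SPB k S where
  α := α
  β₁ := β₁
  βbar := 32 * gameConst G * √k / ((1 - α) ^ 2 * √β₁)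
  p₀ := fun _ => 1 / k
  z := fun q => 4 * gameConst G ^ 2 / (1 - α) *
    (∑ i ∈ Finset.univ.erase (I q), q i ^ (2 - α) + qStar I q ^ (2 - α))
  u := fun q => 8 * gameConst G / (1 - α) * qStar I q ^ (1 - α)
  est := fun p a σ b => G a σ b / p a

/-- The loss vector of round `t` if the outcomes are `x`. -/
def lossSeq {Ω : Type v} (𝒢 : PMGame k d S) (x : ℕ → Ω → Fin d) : ℕ → Ω → Fin k → ℝ :=
  fun t ω a => 𝒢.loss a (x t ω)

/-- The feedback symbol of round `t` if the outcomes are `x` and the actions are `A`. -/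
def obsSeq {Ω : Type v} (𝒢 : PMGame k d S) (x : ℕ → Ω → Fin d) (A : ℕ → Ω → Fin k) :
    ℕ → Ω → S :=
  fun t ω => 𝒢.feedback (A t ω) (x t ω)

/-- The outcomes `x` and the actions `A` arise from the interaction of `alg` with a (randomized and
adaptive) environment. Here `𝓕 t` is everything determined before the action of round `t` is drawn:
the outcomes up to and including round `t`, the actions before round `t`, and possibly more. Given
`𝓕 t`, the action of round `t` is drawn from `p_t`, which `alg` computes from the actions and
the feedback symbols before round `t`. -/
structure IsInteraction {Ω : Type v} [mΩ : MeasurableSpace Ω] (𝒢 : PMGame k d S) (alg : SPB k S)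
    (μ : Measure Ω) (𝓕 : Filtration ℕ mΩ) (x : ℕ → Ω → Fin d) (A : ℕ → Ω → Fin k) : Prop where
  measurable_outcome : ∀ t, Measurable[𝓕 t] (x t)
  measurable_action : ∀ t, Measurable[𝓕 (t + 1)] (A t)
  action_law : ∀ t a, μ[(A t ⁻¹' {a}).indicator (fun _ => (1 : ℝ)) | 𝓕 t] =ᵐ[μ]
    fun ω => alg.p (trajectory A (𝒢.obsSeq x A) ω) t a

end PMGame

end

/-! ### One-dimensional inequalities for the Tsallis entropy -/

theorem rpow_concave_combination {α q r : ℝ} (hα : α ∈ Set.Ioo (0 : ℝ) 1) (hr : r ∈ Set.Icc (0 : ℝ) 1)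
    (h1 : r ≤ 4 * q) (h2 : 1 - r ≤ 4 * (1 - q)) : r ^ α - r ≤ 4 * (q ^ α - q) := by
  have hc := (Real.concaveOn_rpow hα.1.le hα.2.le).2
  have hs0 : 0 ≤ (4 * q - r) / 3 := by linarith
  have hs1 : (4 * q - r) / 3 ≤ 1 := by linarith
  have h := hc (x := r) hr.1 (y := (4 * q - r) / 3) hs0 (a := 1 / 4) (b := 3 / 4) (by norm_num)
    (by norm_num) (by norm_num)
  simp only [smul_eq_mul] at h
  have e : 1 / 4 * r + 3 / 4 * ((4 * q - r) / 3) = q := by ring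
  rw [e] at h
  have h3 : (4 * q - r) / 3 ≤ ((4 * q - r) / 3) ^ α := by
    have := Real.rpow_le_rpow_of_exponent_ge' hs0 hs1 hα.1.le hα.2.le
    simpa using this
  linarith

/-- `log`-type lower bound on the Tsallis divergence to the right of `1`. -/
theorem tsallisDiv_ge_log {α s : ℝ} (hα : α ∈ Set.Ioo (0 : ℝ) 1) (hs : 1 ≤ s) :
    (1 - α) * (s - 1 - Real.log s) ≤ (1 / α) * (1 - s ^ α) + (s - 1) := by
  obtain ⟨h0, h1⟩ := hα
  let F : ℝ → ℝ := fun s => (1 / α) * (1 - s ^ α) + (s - 1) - (1 - α) * (s - 1 - Real.log s)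
  have hd : ∀ x : ℝ, 0 < x → HasDerivAt F
      ((1 / α) * (0 - α * x ^ (α - 1)) + 1 - (1 - α) * (1 - x⁻¹)) x := by
    intro x hx
    exact ((((hasDerivAt_const x (1 : ℝ)).sub
      (Real.hasDerivAt_rpow_const (Or.inl hx.ne'))).const_mul (1 / α)).add
      ((hasDerivAt_id x).sub_const 1)).sub
      ((((hasDerivAt_id x).sub_const 1).sub (Real.hasDerivAt_log hx.ne')).const_mul (1 - α))
  have hm : MonotoneOn F (Set.Ici 1) := by
    apply monotoneOn_of_deriv_nonneg (convex_Ici 1)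
    · intro x hx
      exact (hd x (lt_of_lt_of_le one_pos hx)).continuousAt.continuousWithinAt
    · intro x hx
      rw [interior_Ici] at hx
      exact (hd x (lt_trans one_pos hx)).differentiableAt.differentiableWithinAt
    · intro x hx
      rw [interior_Ici] at hx
      have hx0 : (0 : ℝ) < x := lt_trans one_pos hx
      rw [(hd x hx0).deriv]
      have hb : x ^ α ≤ 1 + α * (x - 1) := by
        have := rpow_one_add_le_one_add_mul_self (s := x - 1) (by linarith) h0.le h1.le
        simpa using this
      rw [Real.rpow_sub_one hx0.ne']
      have : (1 / α) * (0 - α * (x ^ α / x)) + 1 - (1 - α) * (1 - x⁻¹)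
          = (1 + α * (x - 1) - x ^ α) / x := by
        field_simp
        ring
      rw [this]
      exact div_nonneg (by linarith) hx0.le
  have := hm (Set.mem_Ici.2 le_rfl) (Set.mem_Ici.2 hs) hs
  simp only [F, Real.one_rpow, Real.log_one] at this
  linarith

/-- Quadratic lower bound on the Tsallis divergence to the left of `1`. -/
theorem tsallisDiv_ge_sq {α s : ℝ} (hα : α ∈ Set.Ioo (0 : ℝ) 1) (hs : s ∈ Set.Icc (0 : ℝ) 1) :
    (1 - α) * (1 - s) ^ 2 / 2 ≤ (1 / α) * (1 - s ^ α) + (s - 1) := by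
  obtain ⟨h0, h1⟩ := hα
  let F : ℝ → ℝ := fun s => (1 / α) * (1 - s ^ α) + (s - 1) - (1 - α) / 2 * (1 - s) ^ 2
  have hd : ∀ x : ℝ, 0 < x → HasDerivAt F
      ((1 / α) * (0 - α * x ^ (α - 1)) + 1 - (1 - α) / 2 * ((2 : ℕ) * (1 - x) ^ (2 - 1) * (0 - 1)))
      x := by
    intro x hx
    exact ((((hasDerivAt_const x (1 : ℝ)).sub
      (Real.hasDerivAt_rpow_const (Or.inl hx.ne'))).const_mul (1 / α)).add
      ((hasDerivAt_id x).sub_const 1)).sub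
      ((((hasDerivAt_const x (1 : ℝ)).sub (hasDerivAt_id x)).pow 2).const_mul ((1 - α) / 2))
  have hm : AntitoneOn F (Set.Icc 0 1) := by
    apply antitoneOn_of_deriv_nonpos (convex_Icc 0 1)
    · apply Continuous.continuousOn
      have : Continuous fun s : ℝ => s ^ α := Real.continuous_rpow_const h0.le
      fun_prop
    · intro x hx
      rw [interior_Icc] at hx
      exact (hd x hx.1).differentiableAt.differentiableWithinAt
    · intro x hx
      rw [interior_Icc] at hx
      rw [(hd x hx.1).deriv]
      have hb : 1 + (1 - α) * (1 - x) ≤ x ^ (α - 1) := by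
        rw [Real.rpow_def_of_pos hx.1]
        have e1 := Real.add_one_le_exp (Real.log x * (α - 1))
        have e2 := Real.log_le_sub_one_of_pos hx.1
        nlinarith
      have : (1 / α) * (0 - α * x ^ (α - 1)) + 1
          - (1 - α) / 2 * ((2 : ℕ) * (1 - x) ^ (2 - 1) * (0 - 1))
          = 1 + (1 - α) * (1 - x) - x ^ (α - 1) := by
        field_simp
        push_cast
        ring
      rw [this]
      linarith
  have := hm hs (Set.mem_Icc.2 ⟨zero_le_one, le_rfl⟩) hs.2
  simp only [F, Real.one_rpow] at this
  linarith

theorem log_le_quadratic {μ s : ℝ} (hμ : μ ≤ 1 / 2) (hs : 0 < s) :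
    μ * (s - 1) - (s - 1 - Real.log s) ≤ 2 * μ ^ 2 := by
  have h1 : 0 < 1 - μ := by linarith
  have e := Real.log_le_sub_one_of_pos (mul_pos hs h1)
  have e2 := Real.log_le_sub_one_of_pos (inv_pos.2 h1)
  rw [Real.log_mul hs.ne' h1.ne'] at e
  rw [Real.log_inv] at e2
  have e3 : (1 - μ)⁻¹ - 1 ≤ μ + 2 * μ ^ 2 := by
    rw [sub_le_iff_le_add, inv_le_iff_one_le_mul₀ h1]
    nlinarith [mul_nonneg (sq_nonneg μ) (show 0 ≤ 1 - 2 * μ by linarith)]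
  linarith

theorem scaled_stability {α l s : ℝ} (hα : α ∈ Set.Ioo (0 : ℝ) 1) (hs : 0 ≤ s)
    (hl : |l| ≤ (1 - α) / 2) :
    l * (1 - s) - ((1 / α) * (1 - s ^ α) + (s - 1)) ≤ 2 * l ^ 2 / (1 - α) := by
  have h1 : 0 < 1 - α := by linarith [hα.2]
  rcases le_total 1 s with h | h
  · have hg := tsallisDiv_ge_log hα h
    have hμ : -l / (1 - α) ≤ 1 / 2 := by
      rw [div_le_iff₀ h1]
      linarith [neg_abs_le l]
    have hq := mul_le_mul_of_nonneg_left (log_le_quadratic hμ (lt_of_lt_of_le one_pos h)) h1.le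
    have e1 : (1 - α) * (2 * (-l / (1 - α)) ^ 2) = 2 * l ^ 2 / (1 - α) := by
      field_simp
    have e2 : (1 - α) * (-l / (1 - α) * (s - 1) - (s - 1 - Real.log s))
        = l * (1 - s) - (1 - α) * (s - 1 - Real.log s) := by
      field_simp
      ring
    linarith
  · have hg := tsallisDiv_ge_sq hα ⟨hs, h⟩
    rw [le_div_iff₀ h1]
    have : (l * (1 - s) - (1 - α) * (1 - s) ^ 2 / 2) * (1 - α) ≤ 2 * l ^ 2 := by
      nlinarith [sq_nonneg (l - (1 - α) * (1 - s)), sq_nonneg l]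
    nlinarith

/-- One coordinate of the stability term of FTRL with Tsallis entropy. -/
theorem coordinate_stability {α β l x y : ℝ} (hα : α ∈ Set.Ioo (0 : ℝ) 1) (hβ : 0 < β) (hx : 0 < x)
    (hy : 0 ≤ y) (hl : |l| * x ^ (1 - α) ≤ (1 - α) * β / 2) :
    l * (x - y) - β * ((1 / α) * (x ^ α - y ^ α) + x ^ (α - 1) * (y - x)) ≤
      2 / (β * (1 - α)) * (x ^ (2 - α) * l ^ 2) := by
  have h1 : 0 < 1 - α := by linarith [hα.2]
  have hxa : 0 < x ^ α := Real.rpow_pos_of_pos hx _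
  have e1 : x ^ (1 - α) = x / x ^ α := by rw [Real.rpow_sub hx, Real.rpow_one]
  have e2 : x ^ (2 - α) = x ^ 2 / x ^ α := by rw [Real.rpow_sub hx, Real.rpow_two]
  have e3 : x ^ (α - 1) = x ^ α / x := Real.rpow_sub_one hx.ne' _
  have hl' : |l * x ^ (1 - α) / β| ≤ (1 - α) / 2 := by
    rw [abs_div, abs_mul, abs_of_pos hβ, abs_of_pos (Real.rpow_pos_of_pos hx _), div_le_iff₀ hβ]
    linarith
  have hm := mul_le_mul_of_nonneg_left (scaled_stability hα (div_nonneg hy hx.le) hl')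
    (mul_pos hβ hxa).le
  rw [Real.div_rpow hy hx.le] at hm
  rw [e2, e3]
  have hα0 := hα.1.ne'
  have hL : β * x ^ α * (l * (x / x ^ α) / β * (1 - y / x)
      - (1 / α * (1 - y ^ α / x ^ α) + (y / x - 1)))
      = l * (x - y) - β * ((1 / α) * (x ^ α - y ^ α) + x ^ α / x * (y - x)) := by
    field_simp
  have hR : β * x ^ α * (2 * (l * (x / x ^ α) / β) ^ 2 / (1 - α))
      = 2 / (β * (1 - α)) * (x ^ 2 / x ^ α * l ^ 2) := by
    field_simp
  rw [e1, hL, hR] at hm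
  exact hm

/-! ### The Bregman divergence of the Tsallis entropy -/

theorem bregman_tsallis {k : ℕ} {α : ℝ} (hα : α ∈ Set.Ioo (0 : ℝ) 1) (p q : Fin k → ℝ)
    (hq : ∀ i, 0 < q i) :
    bregman (fun p => -tsallis α p) p q =
      ∑ i, ((1 / α) * (q i ^ α - p i ^ α) + q i ^ (α - 1) * (p i - q i)) := by
  have hd : HasFDerivAt (fun p : Fin k → ℝ => -tsallis α p)
      (-((1 / α) • ∑ i, ((α * q i ^ (α - 1)) • ContinuousLinearMap.proj (R := ℝ) i
        - ContinuousLinearMap.proj (R := ℝ) (φ := fun _ : Fin k => ℝ) i))) q := by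
    unfold tsallis
    refine (HasFDerivAt.const_mul ?_ (1 / α)).neg
    refine HasFDerivAt.fun_sum fun i _ => ?_
    have hp : HasFDerivAt (fun p : Fin k → ℝ => p i) (ContinuousLinearMap.proj (R := ℝ) i) q :=
      hasFDerivAt_apply i q
    exact (hp.rpow_const (Or.inl (hq i).ne')).sub hp
  unfold bregman
  rw [hd.fderiv]
  have hα0 := hα.1.ne'
  simp only [tsallis, neg_apply, smul_apply,
    sum_apply, sub_apply, ContinuousLinearMap.proj_apply,
    smul_eq_mul, Pi.sub_apply, Finset.mul_sum]
  rw [← Finset.sum_neg_distrib, ← Finset.sum_neg_distrib, ← Finset.sum_neg_distrib,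
    ← Finset.sum_sub_distrib, ← Finset.sum_sub_distrib]
  refine Finset.sum_congr rfl fun i _ => ?_
  field_simp
  ring

theorem tsallisDiv_nonneg {α x y : ℝ} (hα : α ∈ Set.Ioo (0 : ℝ) 1) (hx : 0 < x) (hy : 0 ≤ y) :
    0 ≤ (1 / α) * (x ^ α - y ^ α) + x ^ (α - 1) * (y - x) := by
  have h1 : 0 < 1 - α := by linarith [hα.2]
  have := coordinate_stability (β := 1) (l := 0) hα one_pos hx hy (by simp; positivity)
  norm_num at this ⊢
  linarith

/-! ### Stability on the simplex -/

section Simplex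

variable {k : ℕ} {α : ℝ} {q : Fin k → ℝ} {I : Fin k}

theorem entry_add_le_one (hq : q ∈ stdSimplex ℝ (Fin k)) {i j : Fin k} (hij : i ≠ j) :
    q i + q j ≤ 1 := by
  rw [← hq.2, ← Finset.sum_pair hij]
  exact Finset.sum_le_sum_of_subset_of_nonneg (Finset.subset_univ _) fun m _ _ => hq.1 m

theorem entry_le_one (hq : q ∈ stdSimplex ℝ (Fin k)) (i : Fin k) : q i ≤ 1 := by
  rw [← hq.2]
  exact Finset.single_le_sum (fun m _ => hq.1 m) (Finset.mem_univ i)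

theorem sum_erase_entry (hq : q ∈ stdSimplex ℝ (Fin k)) (i : Fin k) :
    ∑ j ∈ Finset.univ.erase i, q j = 1 - q i := by
  rw [← hq.2, ← Finset.add_sum_erase _ _ (Finset.mem_univ i)]
  ring

theorem entry_le_min (hq : q ∈ stdSimplex ℝ (Fin k)) (hI : ∀ i, q i ≤ q I) {i : Fin k}
    (hi : i ≠ I) : q i ≤ min (q I) (1 - q I) :=
  le_min (hI i) (by linarith [entry_add_le_one hq hi])

theorem entry_le_min_of_le_half (hq : q ∈ stdSimplex ℝ (Fin k)) (hI : ∀ i, q i ≤ q I) {i : Fin k}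
    (hi : q i ≤ 1 / 2) : q i ≤ min (q I) (1 - q I) := by
  by_cases h : i = I
  · subst h
    exact le_min le_rfl (by linarith)
  · exact entry_le_min hq hI h

theorem min_nonneg_of_mem (hq : q ∈ stdSimplex ℝ (Fin k)) : 0 ≤ min (q I) (1 - q I) :=
  le_min (hq.1 I) (by linarith [entry_le_one hq I])

theorem sum_rpow_le {s : Finset (Fin k)} (hα : α ∈ Set.Ioo (0 : ℝ) 1)
    (hq : ∀ i, 0 ≤ q i) {m : ℝ} (hm : ∀ i ∈ s, q i ≤ m) (hs : ∑ i ∈ s, q i ≤ m) :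
    ∑ i ∈ s, q i ^ (2 - α) ≤ m ^ (2 - α) := by
  have hm0 : 0 ≤ m := (Finset.sum_nonneg fun i _ => hq i).trans hs
  have h1 : 0 < 1 - α := by linarith [hα.2]
  have key : ∀ x : ℝ, 0 ≤ x → x ^ (2 - α) = x * x ^ (1 - α) := by
    intro x hx
    rcases hx.eq_or_lt with rfl | hx
    · rw [Real.zero_rpow (by linarith), zero_mul]
    · rw [show (2 - α : ℝ) = 1 + (1 - α) by ring, Real.rpow_add hx, Real.rpow_one]
  calc ∑ i ∈ s, q i ^ (2 - α) ≤ ∑ i ∈ s, q i * m ^ (1 - α) := by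
        refine Finset.sum_le_sum fun i hi => ?_
        rw [key _ (hq i)]
        exact mul_le_mul_of_nonneg_left (Real.rpow_le_rpow (hq i) (hm i hi) h1.le) (hq i)
    _ = (∑ i ∈ s, q i) * m ^ (1 - α) := by rw [Finset.sum_mul]
    _ ≤ m * m ^ (1 - α) := mul_le_mul_of_nonneg_right hs (Real.rpow_nonneg hm0 _)
    _ = m ^ (2 - α) := (key m hm0).symm

/-- The stability term of FTRL with Tsallis entropy on the simplex. -/
theorem simplex_stability {β : ℝ} {l p : Fin k → ℝ} (hα : α ∈ Set.Ioo (0 : ℝ) 1) (hβ : 0 < β)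
    (hq : q ∈ stdSimplex ℝ (Fin k)) (hq0 : ∀ i, 0 < q i) (hI : ∀ i, q i ≤ q I)
    (hp : p ∈ stdSimplex ℝ (Fin k))
    (hl : ∀ i, |l i| * min (q I) (1 - q I) ^ (1 - α) ≤ (1 - α) * β / 8) :
    ∑ i, l i * (q i - p i) - β * bregman (fun p => -tsallis α p) p q ≤
      4 / (β * (1 - α)) * (∑ i ∈ Finset.univ.erase I, q i ^ (2 - α) * l i ^ 2
        + min (q I) (1 - q I) ^ (2 - α) * l I ^ 2) := by
  have h1 : 0 < 1 - α := by linarith [hα.2]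
  have hK : 0 < 1 / (β * (1 - α)) := by positivity
  rw [bregman_tsallis hα p q hq0, Finset.mul_sum]
  rcases le_or_gt (q I) (1 / 2) with hI2 | hI2
  · have hmin : min (q I) (1 - q I) = q I := min_eq_left (by linarith)
    rw [hmin] at hl ⊢
    rw [← Finset.sum_sub_distrib, Finset.sum_erase_add _ _ (Finset.mem_univ I), Finset.mul_sum]
    refine Finset.sum_le_sum fun i _ => ?_
    have hx : q i ^ (1 - α) ≤ q I ^ (1 - α) := Real.rpow_le_rpow (hq0 i).le (hI i) h1.le
    refine (coordinate_stability hα hβ (hq0 i) (hp.1 i) ?_).trans ?_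
    · nlinarith [mul_le_mul_of_nonneg_left hx (abs_nonneg (l i)), hl i, mul_pos h1 hβ]
    · have : 0 ≤ q i ^ (2 - α) * l i ^ 2 :=
        mul_nonneg (Real.rpow_nonneg (hq0 i).le _) (sq_nonneg _)
      refine mul_le_mul_of_nonneg_right ?_ this
      gcongr
      norm_num
  · have hmin : min (q I) (1 - q I) = 1 - q I := min_eq_right (by linarith)
    rw [hmin] at hl ⊢
    have hsum : ∑ i, l i * (q i - p i)
        = ∑ i ∈ Finset.univ.erase I, (l i - l I) * (q i - p i) := by
      have h0 : ∑ i, (q i - p i) = 0 := by rw [Finset.sum_sub_distrib, hq.2, hp.2, sub_self]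
      have h2 : ∑ i, l i * (q i - p i) = ∑ i, (l i - l I) * (q i - p i) := by
        simp only [sub_mul (l _) (l I)]
        rw [Finset.sum_sub_distrib, ← Finset.mul_sum, h0]
        ring
      rw [h2, ← Finset.sum_erase_add _ _ (Finset.mem_univ I)]
      ring
    rw [hsum, ← Finset.sum_erase_add _ (fun i => β * _) (Finset.mem_univ I)]
    have hdI := mul_nonneg hβ.le (tsallisDiv_nonneg hα (hq0 I) (hp.1 I))
    have hcoord : ∀ i ∈ Finset.univ.erase I, (l i - l I) * (q i - p i)
        - β * ((1 / α) * (q i ^ α - p i ^ α) + q i ^ (α - 1) * (p i - q i)) ≤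
        4 / (β * (1 - α)) * (q i ^ (2 - α) * l i ^ 2)
          + 4 / (β * (1 - α)) * l I ^ 2 * q i ^ (2 - α) := by
      intro i hi
      have hqm := entry_le_min hq hI (Finset.ne_of_mem_erase hi)
      rw [hmin] at hqm
      have hx : q i ^ (1 - α) ≤ (1 - q I) ^ (1 - α) := Real.rpow_le_rpow (hq0 i).le hqm h1.le
      refine (coordinate_stability hα hβ (hq0 i) (hp.1 i) ?_).trans ?_
      · have ha : |l i - l I| ≤ |l i| + |l I| := abs_sub _ _
        have hb : |l i - l I| * q i ^ (1 - α) ≤ (|l i| + |l I|) * (1 - q I) ^ (1 - α) :=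
          mul_le_mul ha hx (Real.rpow_nonneg (hq0 i).le _) (by positivity)
        nlinarith [hl i, hl I, mul_pos h1 hβ]
      · have hsq : (l i - l I) ^ 2 ≤ 2 * l i ^ 2 + 2 * l I ^ 2 := by
          nlinarith [sq_nonneg (l i + l I)]
        have hc : 0 ≤ 2 / (β * (1 - α)) * q i ^ (2 - α) := by
          have := Real.rpow_nonneg (hq0 i).le (2 - α)
          positivity
        calc _ = 2 / (β * (1 - α)) * q i ^ (2 - α) * (l i - l I) ^ 2 := by ring
          _ ≤ 2 / (β * (1 - α)) * q i ^ (2 - α) * (2 * l i ^ 2 + 2 * l I ^ 2) :=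
            mul_le_mul_of_nonneg_left hsq hc
          _ = _ := by ring
    have hS := Finset.sum_le_sum hcoord
    rw [Finset.sum_sub_distrib, Finset.sum_add_distrib, ← Finset.mul_sum, ← Finset.mul_sum] at hS
    have hr : ∑ i ∈ Finset.univ.erase I, q i ^ (2 - α) ≤ (1 - q I) ^ (2 - α) := by
      refine sum_rpow_le hα (fun i => (hq0 i).le) (fun i hi => ?_) (sum_erase_entry hq I).le
      linarith [entry_add_le_one hq (Finset.ne_of_mem_erase hi)]
    have hr2 := mul_le_mul_of_nonneg_left hr
      (show 0 ≤ 4 / (β * (1 - α)) * l I ^ 2 by positivity)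
    rw [← Finset.mul_sum] at hS ⊢
    linarith

end Simplex

/-! ### The Tsallis entropy on the simplex -/

theorem sum_rpow_le_card_rpow {ι : Type*} {α : ℝ} (hα : α ∈ Set.Ioo (0 : ℝ) 1) (s : Finset ι)
    {q : ι → ℝ} (hq : ∀ i, 0 ≤ q i) :
    ∑ i ∈ s, q i ^ α ≤ (s.card : ℝ) ^ (1 - α) * (∑ i ∈ s, q i) ^ α := by
  have h0 : 0 ≤ ∑ i ∈ s, q i ^ α := Finset.sum_nonneg fun i _ => Real.rpow_nonneg (hq i) _
  have h := Real.rpow_sum_le_const_mul_sum_rpow_of_nonneg s (f := fun i => q i ^ α) (p := 1 / α)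
    (by rw [le_div_iff₀ hα.1]; linarith [hα.2]) fun i _ => Real.rpow_nonneg (hq i) _
  have e : ∀ x : ℝ, 0 ≤ x → (x ^ α) ^ (1 / α) = x := fun x hx => by
    rw [← Real.rpow_mul hx, mul_one_div_cancel hα.1.ne', Real.rpow_one]
  have h' := Real.rpow_le_rpow (Real.rpow_nonneg h0 _) h hα.1.le
  rw [← Real.rpow_mul h0, one_div_mul_cancel hα.1.ne', Real.rpow_one,
    Real.mul_rpow (Real.rpow_nonneg (Nat.cast_nonneg _) _)
      (Finset.sum_nonneg fun i _ => Real.rpow_nonneg (Real.rpow_nonneg (hq i) _) _),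
    ← Real.rpow_mul (Nat.cast_nonneg _), Finset.sum_congr rfl fun i _ => e _ (hq i)] at h'
  have e2 : (1 / α - 1) * α = 1 - α := by
    have := hα.1.ne'
    field_simp
  rwa [e2] at h'

theorem half_rpow_le {α : ℝ} (hα : α ∈ Set.Ioo (0 : ℝ) 1) :
    (1 / 2 : ℝ) ^ (1 - α) ≤ 1 - (1 - α) / 2 := by
  have := rpow_one_add_le_one_add_mul_self (s := -1 / 2) (p := 1 - α) (by norm_num)
    (by linarith [hα.2]) (by linarith [hα.1])
  norm_num at this ⊢
  linarith

theorem quarter_rpow_le {α : ℝ} (hα : α ∈ Set.Ioo (0 : ℝ) 1) :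
    (4 : ℝ) ^ (α - 1) ≤ 1 - 3 / 4 * (1 - α) := by
  have := rpow_one_add_le_one_add_mul_self (s := -3 / 4) (p := 1 - α) (by norm_num)
    (by linarith [hα.2]) (by linarith [hα.1])
  have e : (4 : ℝ) ^ (α - 1) = (1 / 4) ^ (1 - α) := by
    rw [one_div, Real.inv_rpow (by norm_num), ← Real.rpow_neg (by norm_num)]
    congr 1
    ring
  rw [e]
  norm_num at this ⊢
  linarith

section Simplex

variable {k : ℕ} {α : ℝ} {q : Fin k → ℝ} {I : Fin k}

theorem le_rpow_self {α x : ℝ} (hα : α ∈ Set.Ioo (0 : ℝ) 1) (hx : 0 ≤ x) (hx1 : x ≤ 1) :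
    x ≤ x ^ α := by
  simpa using Real.rpow_le_rpow_of_exponent_ge' hx hx1 hα.1.le hα.2.le

theorem tsallis_nonneg (hα : α ∈ Set.Ioo (0 : ℝ) 1) (hq : q ∈ stdSimplex ℝ (Fin k)) :
    0 ≤ tsallis α q :=
  mul_nonneg (one_div_nonneg.2 hα.1.le) (Finset.sum_nonneg fun i _ =>
    sub_nonneg.2 (le_rpow_self hα (hq.1 i) (entry_le_one hq i)))

/-- If `r ≤ 4 q` on the entries where `q` is at most `1 / 2`, then `H_α(r) ≤ 4 H_α(q)`. -/
theorem tsallis_le_of_entry_le (hα : α ∈ Set.Ioo (0 : ℝ) 1) (hq : q ∈ stdSimplex ℝ (Fin k))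
    {r : Fin k → ℝ} (hr : r ∈ stdSimplex ℝ (Fin k)) (h : ∀ i, q i ≤ 1 / 2 → r i ≤ 4 * q i) :
    tsallis α r ≤ 4 * tsallis α q := by
  unfold tsallis
  rw [mul_left_comm, Finset.mul_sum _ _ (4 : ℝ)]
  refine mul_le_mul_of_nonneg_left (Finset.sum_le_sum fun i _ => ?_) (one_div_nonneg.2 hα.1.le)
  refine rpow_concave_combination hα ⟨hr.1 i, entry_le_one hr i⟩ ?_ ?_
  · rcases le_or_gt (q i) (1 / 2) with hi | hi
    · exact h i hi
    · linarith [entry_le_one hr i]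
  · rcases le_or_gt (q i) (1 / 2) with hi | hi
    · linarith [hr.1 i]
    · rw [← sum_erase_entry hr, ← sum_erase_entry hq, Finset.mul_sum]
      refine Finset.sum_le_sum fun j hj => h j ?_
      linarith [entry_add_le_one hq (Finset.ne_of_mem_erase hj)]

/-- The effective mass `m` of the non-maximal entries controls the entropy and the exploration
terms. -/
theorem exists_effective_mass (hα : α ∈ Set.Ioo (0 : ℝ) 1) (hq : q ∈ stdSimplex ℝ (Fin k))
    (hq0 : ∀ i, 0 < q i) (hI : ∀ i, q i ≤ q I) :
    ∃ m : ℝ, 0 ≤ m ∧ m ≤ 1 ∧ min (q I) (1 - q I) ≤ m ∧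
      ∑ i ∈ Finset.univ.erase I, q i ^ (2 - α) + min (q I) (1 - q I) ^ (2 - α)
        ≤ 2 * m ^ (2 - α) ∧
      (1 - α) * m ^ α / (2 * α) ≤ tsallis α q ∧
      tsallis α q ≤ (k : ℝ) ^ (1 - α) * m ^ α / α ∧
      ∀ a, m ≤ 2 * (1 - q a) := by
  have h1 : 0 < 1 - α := by linarith [hα.2]
  have hα0 := hα.1
  have hmin0 := min_nonneg_of_mem (I := I) hq
  have hfac : ∀ x y : ℝ, 0 < x → x ≤ y → x * y ^ (α - 1) ≤ x ^ α := by
    intro x y hx hxy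
    have : y ^ (α - 1) ≤ x ^ (α - 1) := Real.rpow_le_rpow_of_nonpos hx hxy (by linarith)
    calc x * y ^ (α - 1) ≤ x * x ^ (α - 1) := mul_le_mul_of_nonneg_left this hx.le
      _ = x ^ α := by rw [Real.rpow_sub_one hx.ne']; field_simp
  rcases le_or_gt (q I) (1 / 2) with hI2 | hI2
  · have hm1 : min (q I) (1 - q I) ≤ 1 := (min_le_left _ _).trans (by linarith)
    refine ⟨1, zero_le_one, le_rfl, hm1, ?_, ?_, ?_, fun a => by linarith [hI a]⟩
    · have ha : ∑ i ∈ Finset.univ.erase I, q i ^ (2 - α) ≤ (1 : ℝ) ^ (2 - α) := by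
        refine sum_rpow_le hα hq.1 (fun i _ => entry_le_one hq i) ?_
        rw [sum_erase_entry hq]
        linarith [hq0 I]
      have hb : min (q I) (1 - q I) ^ (2 - α) ≤ (1 : ℝ) ^ (2 - α) :=
        Real.rpow_le_rpow hmin0 hm1 (by linarith)
      linarith
    · have hs : ∑ i, q i * (1 / 2 : ℝ) ^ (α - 1) ≤ ∑ i, q i ^ α :=
        Finset.sum_le_sum fun i _ => hfac _ _ (hq0 i) ((hI i).trans hI2)
      rw [← Finset.sum_mul, hq.2, one_mul] at hs
      have h2 : 1 + (1 - α) / 2 ≤ (1 / 2 : ℝ) ^ (α - 1) := by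
        have e : (1 / 2 : ℝ) ^ (α - 1) * (1 / 2) ^ (1 - α) = 1 := by
          rw [← Real.rpow_add (by norm_num)]
          simp
        have hp : (0 : ℝ) < (1 / 2) ^ (α - 1) := by positivity
        nlinarith [half_rpow_le hα]
      unfold tsallis
      rw [Finset.sum_sub_distrib, hq.2, Real.one_rpow]
      calc (1 - α) * 1 / (2 * α) = 1 / α * ((1 - α) / 2) := by field_simp
        _ ≤ _ := mul_le_mul_of_nonneg_left (by linarith) (by positivity)
    · have hs := sum_rpow_le_card_rpow hα Finset.univ hq.1
      rw [hq.2, Real.one_rpow, Finset.card_univ, Fintype.card_fin] at hs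
      unfold tsallis
      rw [Finset.sum_sub_distrib, hq.2, Real.one_rpow, one_div_mul_eq_div]
      gcongr
      linarith
  · have hmm : min (q I) (1 - q I) = 1 - q I := min_eq_right (by linarith)
    rw [hmm] at hmin0 ⊢
    have hle : ∀ i ∈ Finset.univ.erase I, q i ≤ 1 - q I := fun i hi => by
      linarith [entry_add_le_one hq (Finset.ne_of_mem_erase hi)]
    refine ⟨1 - q I, hmin0, by linarith, le_rfl, ?_, ?_, ?_, fun a => by linarith [hI a]⟩
    · linarith [sum_rpow_le hα hq.1 hle (sum_erase_entry hq I).le]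
    · have hs : ∑ i ∈ Finset.univ.erase I, (q i * (1 - q I) ^ (α - 1) - q i)
          ≤ ∑ i ∈ Finset.univ.erase I, (q i ^ α - q i) :=
        Finset.sum_le_sum fun i hi => sub_le_sub_right (hfac _ _ (hq0 i) (hle i hi)) _
      rw [Finset.sum_sub_distrib, ← Finset.sum_mul, sum_erase_entry hq] at hs
      have hb : (1 - α) / 2 * (1 - q I) ^ α ≤ (1 - q I) * (1 - q I) ^ (α - 1) - (1 - q I) := by
        rcases hmin0.eq_or_lt with h0 | h0
        · rw [← h0, Real.zero_rpow hα0.ne']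
          simp
        · have e1 : (1 - q I) * (1 - q I) ^ (α - 1) = (1 - q I) ^ α := by
            rw [Real.rpow_sub_one h0.ne']
            field_simp
          have e2 : (1 - q I) = (1 - q I) ^ α * (1 - q I) ^ (1 - α) := by
            rw [← Real.rpow_add h0]
            simp
          have e3 : (1 - q I) ^ (1 - α) ≤ 1 - (1 - α) / 2 :=
            (Real.rpow_le_rpow hmin0 (by linarith) h1.le).trans (half_rpow_le hα)
          have e4 : 0 < (1 - q I) ^ α := Real.rpow_pos_of_pos h0 _
          rw [e1]
          nlinarith
      have hqI := le_rpow_self hα (hq.1 I) (entry_le_one hq I)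
      unfold tsallis
      rw [← Finset.sum_erase_add _ _ (Finset.mem_univ I)]
      calc (1 - α) * (1 - q I) ^ α / (2 * α) = 1 / α * ((1 - α) / 2 * (1 - q I) ^ α) := by
            field_simp
        _ ≤ _ := mul_le_mul_of_nonneg_left (by linarith) (by positivity)
    · have hs := sum_rpow_le_card_rpow hα (Finset.univ.erase I) hq.1
      rw [sum_erase_entry hq] at hs
      have hc : (((Finset.univ.erase I).card : ℕ) : ℝ) ^ (1 - α) ≤ (k : ℝ) ^ (1 - α) := by
        refine Real.rpow_le_rpow (Nat.cast_nonneg _) ?_ h1.le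
        exact_mod_cast (Finset.card_le_univ _).trans (Fintype.card_fin k).le
      have hs' := hs.trans (mul_le_mul_of_nonneg_right hc (Real.rpow_nonneg hmin0 α))
      have hqI : q I ^ α ≤ 1 := Real.rpow_le_one (hq.1 I) (entry_le_one hq I) hα0.le
      unfold tsallis
      rw [Finset.sum_sub_distrib, hq.2, ← Finset.sum_erase_add _ _ (Finset.mem_univ I),
        one_div_mul_eq_div]
      gcongr
      linarith

end Simplex

/-! ### Interior and optimality of the FTRL minimizer -/

namespace SPB

variable {k : ℕ} {O : Type u} (alg : SPB k O)

/-- The contribution of one coordinate to the FTRL objective. -/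
noncomputable def coordObjective (c β x : ℝ) : ℝ :=
  c * x + β * (-((1 / alg.α) * (x ^ alg.α - x)))
    + alg.βbar * (-((1 / (1 - alg.α)) * (x ^ (1 - alg.α) - x)))

theorem objective_eq_sum (L : Fin k → ℝ) (β : ℝ) (p : Fin k → ℝ) :
    alg.objective L β p = ∑ i, alg.coordObjective (L i) β (p i) := by
  simp only [objective, coordObjective, tsallis, Finset.sum_add_distrib, Finset.mul_sum,
    Finset.sum_neg_distrib, mul_neg]

theorem hasDerivAt_coordObjective (hα : alg.α ∈ Set.Ioo (0 : ℝ) 1) (c β : ℝ) {x : ℝ} (hx : 0 < x) :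
    HasDerivAt (alg.coordObjective c β)
      (c - β * x ^ (alg.α - 1) - alg.βbar * x ^ (-alg.α) + β / alg.α + alg.βbar / (1 - alg.α)) x := by
  have h1 : 1 - alg.α ≠ 0 := by linarith [hα.2]
  have h0 := hα.1.ne'
  have hd := (((hasDerivAt_id x).const_mul c).add
    ((((Real.hasDerivAt_rpow_const (p := alg.α) (Or.inl hx.ne')).sub (hasDerivAt_id x)).const_mul
      (1 / alg.α)).neg.const_mul β)).add
    ((((Real.hasDerivAt_rpow_const (p := 1 - alg.α) (Or.inl hx.ne')).sub
      (hasDerivAt_id x)).const_mul (1 / (1 - alg.α))).neg.const_mul alg.βbar)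
  refine HasDerivAt.congr_deriv hd ?_
  rw [show (1 - alg.α - 1 : ℝ) = -alg.α by ring]
  field_simp
  ring

theorem add_transfer_mem {q : Fin k → ℝ} (hq : q ∈ stdSimplex ℝ (Fin k)) {i j : Fin k}
    (hij : i ≠ j) {s : ℝ} (hi : 0 ≤ q i + s) (hj : 0 ≤ q j - s) :
    q + s • (Pi.single i 1 - Pi.single j 1 : Fin k → ℝ) ∈ stdSimplex ℝ (Fin k) := by
  refine ⟨fun m => ?_, ?_⟩
  · rcases eq_or_ne m i with rfl | hmi
    · simpa [hij] using hi
    · rcases eq_or_ne m j with rfl | hmj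
      · simpa [hmi, ← sub_eq_add_neg] using hj
      · simpa [hmi, hmj] using hq.1 m
  · simp [Finset.sum_add_distrib, ← Finset.mul_sum, hq.2]

theorem sum_transfer {q : Fin k → ℝ} {i j : Fin k} (hij : i ≠ j) (s : ℝ) (f : Fin k → ℝ → ℝ) :
    ∑ m, f m ((q + s • (Pi.single i 1 - Pi.single j 1 : Fin k → ℝ)) m) - ∑ m, f m (q m) =
      (f i (q i + s) - f i (q i)) + (f j (q j - s) - f j (q j)) := by
  rw [← Finset.sum_sub_distrib, ← Finset.sum_subset (Finset.subset_univ {i, j}),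
    Finset.sum_pair hij]
  · simp [hij, hij.symm, ← sub_eq_add_neg]
  · intro m _ hm
    simp only [Finset.mem_insert, Finset.mem_singleton, not_or] at hm
    simp [hm.1, hm.2]

variable {alg}

theorem pos_of_isMinOn (hα : alg.α ∈ Set.Ioo (0 : ℝ) 1) (hbar : 0 ≤ alg.βbar) {L : Fin k → ℝ}
    {β : ℝ} (hβ : 0 < β) {q : Fin k → ℝ} (hq : q ∈ stdSimplex ℝ (Fin k))
    (hmin : IsMinOn (alg.objective L β) (stdSimplex ℝ (Fin k)) q) (i : Fin k) : 0 < q i := by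
  by_contra hi
  have hi0 : q i = 0 := le_antisymm (not_lt.1 hi) (hq.1 i)
  have h0 := hα.1
  have h1 : 0 < 1 - alg.α := by linarith [hα.2]
  obtain ⟨j, hj⟩ : ∃ j, 0 < q j := by
    by_contra! h
    have := Finset.sum_nonpos (s := Finset.univ) fun m _ => h m
    rw [hq.2] at this
    linarith
  have hij : i ≠ j := by
    rintro rfl
    exact hi hj
  have hdj := alg.hasDerivAt_coordObjective hα (L j) β hj
  rw [← sub_zero (q j)] at hdj
  have hslope := (hdj.comp_const_sub (q j) 0).tendsto_slope_zero_right
  have hpow : Filter.Tendsto (fun t : ℝ => L i + β / alg.α - β / alg.α * t ^ (alg.α - 1))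
      (nhdsWithin 0 (Set.Ioi 0)) Filter.atBot := by
    have ht := (tendsto_rpow_neg_nhdsGT_zero (y := alg.α - 1) (by linarith)).const_mul_atTop
      (div_pos hβ h0)
    exact Filter.tendsto_atBot_add_const_left _ (L i + β / alg.α)
      (Filter.tendsto_neg_atTop_atBot.comp ht)
  have hneg := (hpow.atBot_add hslope).eventually (Filter.eventually_lt_atBot 0)
  have hsmall : Set.Ioo 0 (min 1 (q j)) ∈ nhdsWithin (0 : ℝ) (Set.Ioi 0) :=
    Ioo_mem_nhdsGT (lt_min one_pos hj)
  obtain ⟨t, ht, htI⟩ := (hneg.and hsmall).exists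
  have ht0 : 0 < t := htI.1
  have ht1 : t < 1 := htI.2.trans_le (min_le_left _ _)
  have htj : t < q j := htI.2.trans_le (min_le_right _ _)
  have hm := hmin (add_transfer_mem hq hij (s := t) (by linarith) (by linarith))
  simp only [Set.mem_ofPred_eq, objective_eq_sum] at hm
  have hs := sum_transfer (q := q) hij t fun m => alg.coordObjective (L m) β
  have hzero : alg.coordObjective (L i) β 0 = 0 := by
    simp [coordObjective, Real.zero_rpow h0.ne', Real.zero_rpow h1.ne']
  have hcoord : t⁻¹ * alg.coordObjective (L i) β t ≤
      L i + β / alg.α - β / alg.α * t ^ (alg.α - 1) := by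
    have e : t⁻¹ * alg.coordObjective (L i) β t = L i + β / alg.α - β / alg.α * t ^ (alg.α - 1)
        - alg.βbar / (1 - alg.α) * (t ^ (1 - alg.α) - t) / t := by
      rw [coordObjective, Real.rpow_sub_one ht0.ne']
      field_simp
      ring
    have hp : t ≤ t ^ (1 - alg.α) := le_rpow_self ⟨h1, by linarith⟩ ht0.le ht1.le
    have : 0 ≤ alg.βbar / (1 - alg.α) * (t ^ (1 - alg.α) - t) / t :=
      div_nonneg (mul_nonneg (div_nonneg hbar h1.le) (sub_nonneg.2 hp)) ht0.le
    linarith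
  simp only [zero_add, sub_zero, smul_eq_mul, hi0, hzero] at ht hs
  have hsum : 0 ≤ t⁻¹ * alg.coordObjective (L i) β t + t⁻¹ * (alg.coordObjective (L j) β (q j - t)
      - alg.coordObjective (L j) β (q j)) := by
    rw [← mul_add]
    exact mul_nonneg (inv_nonneg.2 ht0.le) (by linarith)
  linarith

theorem kkt_of_isMinOn (hα : alg.α ∈ Set.Ioo (0 : ℝ) 1) {L : Fin k → ℝ}
    {β : ℝ} {q : Fin k → ℝ} (hq : q ∈ stdSimplex ℝ (Fin k)) (hq0 : ∀ i, 0 < q i)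
    (hmin : IsMinOn (alg.objective L β) (stdSimplex ℝ (Fin k)) q) (i j : Fin k) :
    L i - β * q i ^ (alg.α - 1) - alg.βbar * q i ^ (-alg.α) =
      L j - β * q j ^ (alg.α - 1) - alg.βbar * q j ^ (-alg.α) := by
  rcases eq_or_ne i j with rfl | hij
  · rfl
  let F : ℝ → ℝ := fun s => alg.coordObjective (L i) β (q i + s)
    + alg.coordObjective (L j) β (q j - s)
  have hi := alg.hasDerivAt_coordObjective hα (L i) β (hq0 i)
  have hj := alg.hasDerivAt_coordObjective hα (L j) β (hq0 j)
  rw [← add_zero (q i)] at hi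
  rw [← sub_zero (q j)] at hj
  have hF := (hi.comp_const_add (q i) 0).add (hj.comp_const_sub (q j) 0)
  have hloc : IsLocalMin F 0 := by
    have hn : Set.Ioo (-q i) (q j) ∈ nhds (0 : ℝ) :=
      Ioo_mem_nhds (by linarith [hq0 i]) (hq0 j)
    filter_upwards [hn] with s hs
    have hm := hmin (add_transfer_mem hq hij (s := s) (by linarith [hs.1]) (by linarith [hs.2]))
    simp only [Set.mem_ofPred_eq, objective_eq_sum] at hm
    have ht := sum_transfer (q := q) hij s fun m => alg.coordObjective (L m) β
    simp only [F, add_zero, sub_zero]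
    linarith
  have := hloc.hasDerivAt_eq_zero hF
  simp only [add_zero, sub_zero] at this
  linarith

end SPB

/-! ### Stability of the penalty -/

theorem barrier_lt {α β Δ b B x m : ℝ} (hα : α ∈ Set.Ioo (0 : ℝ) 1) (hβ : 0 < β) (hΔ : 0 ≤ Δ)
    (hb : 0 ≤ b) (hx : 0 < x) (hxm : x ≤ m) (hB : B * x ^ (1 - α) ≤ (1 - α) * β / 8)
    (hΔ₁ : α ≤ 1 / 2 → Δ ≤ (1 - α) * β / 16) (hΔ₂ : 1 / 2 < α → Δ ≤ b / 2 * m ^ (1 - 2 * α)) :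
    (β + Δ) * (4 * x) ^ (α - 1) + b * (4 * x) ^ (-α) <
      β * x ^ (α - 1) + b * x ^ (-α) - 2 * B := by
  have h0 := hα.1
  have h1 : 0 < 1 - α := by linarith [hα.2]
  have hX : 0 < x ^ (α - 1) := Real.rpow_pos_of_pos hx _
  have hY : 0 < x ^ (-α) := Real.rpow_pos_of_pos hx _
  have hB' : B ≤ (1 - α) * β / 8 * x ^ (α - 1) := by
    have e : x ^ (1 - α) * x ^ (α - 1) = 1 := by
      rw [← Real.rpow_add hx]
      simp
    have := mul_le_mul_of_nonneg_right hB hX.le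
    rwa [mul_assoc, e, mul_one] at this
  have h4 := quarter_rpow_le hα
  have h4p : (0 : ℝ) < 4 ^ (α - 1) := by positivity
  rw [Real.mul_rpow (by norm_num) hx.le, Real.mul_rpow (by norm_num) hx.le]
  have hmain : β * (4 ^ (α - 1) * x ^ (α - 1)) ≤ β * ((1 - 3 / 4 * (1 - α)) * x ^ (α - 1)) := by
    gcongr
  have hpos : 0 < (1 - α) * β * x ^ (α - 1) := by positivity
  have hlow : Δ * (4 ^ (α - 1) * x ^ (α - 1)) ≤ Δ * x ^ (α - 1) := by
    refine mul_le_mul_of_nonneg_left ?_ hΔ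
    nlinarith
  rcases le_or_gt α (1 / 2) with h | h
  · have hd := mul_le_mul_of_nonneg_right (hΔ₁ h) hX.le
    have hq : (4 : ℝ) ^ (-α) ≤ 1 := Real.rpow_le_one_of_one_le_of_nonpos (by norm_num) (by linarith)
    have hbq : b * (4 ^ (-α) * x ^ (-α)) ≤ b * x ^ (-α) := by
      refine mul_le_mul_of_nonneg_left ?_ hb
      nlinarith
    nlinarith
  · have hq : (4 : ℝ) ^ (-α) ≤ 1 / 2 := by
      have : (4 : ℝ) ^ (-α) ≤ 4 ^ (-(1 / 2) : ℝ) :=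
        Real.rpow_le_rpow_of_exponent_le (by norm_num) (by linarith)
      refine this.trans_eq ?_
      rw [show (4 : ℝ) = 2 ^ (2 : ℝ) by norm_num, ← Real.rpow_mul (by norm_num)]
      norm_num
    have hbq : b * (4 ^ (-α) * x ^ (-α)) ≤ b / 2 * x ^ (-α) := by
      calc b * (4 ^ (-α) * x ^ (-α)) ≤ b * (1 / 2 * x ^ (-α)) := by gcongr
        _ = _ := by ring
    have hd : Δ * x ^ (α - 1) ≤ b / 2 * x ^ (-α) := by
      have hmx : m ^ (1 - 2 * α) ≤ x ^ (1 - 2 * α) :=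
        Real.rpow_le_rpow_of_nonpos hx hxm (by linarith)
      calc Δ * x ^ (α - 1) ≤ b / 2 * x ^ (1 - 2 * α) * x ^ (α - 1) := by
            refine mul_le_mul_of_nonneg_right ((hΔ₂ h).trans ?_) hX.le
            exact mul_le_mul_of_nonneg_left hmx (by positivity)
        _ = b / 2 * x ^ (-α) := by
            rw [mul_assoc, ← Real.rpow_add hx]
            congr 2
            ring
    nlinarith

/-- The increment of the learning-rate parameter. -/
theorem increment_le {α β c m h z u : ℝ} (hα : α ∈ Set.Ioo (0 : ℝ) 1) (hc : 1 ≤ c)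
    (hβ : 64 * c ^ 2 / (1 - α) ≤ β) (hm : 0 < m) (hm1 : m ≤ 1)
    (hz : z ≤ 8 * c ^ 2 / (1 - α) * m ^ (2 - α))
    (hu0 : 0 ≤ u) (hu : u ≤ 8 * c / (1 - α) * m ^ (1 - α))
    (hh : (1 - α) * m ^ α / (2 * α) ≤ h) :
    1 / h * (2 * √(z / β) + u / β) * ((1 - α) * √((1 - α) * β)) ≤ 14 * α * c * m ^ (1 - 2 * α) := by
  have h0 := hα.1
  have h1 : 0 < 1 - α := by linarith [hα.2]
  have hβ0 : 0 < β := lt_of_lt_of_le (by positivity) hβ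
  have hD2 : √((1 - α) * β) ^ 2 = (1 - α) * β := Real.sq_sqrt (by positivity)
  have hD8 : 8 * c ≤ √((1 - α) * β) := by
    refine Real.le_sqrt_of_sq_le ?_
    rw [div_le_iff₀ h1] at hβ
    nlinarith
  set D := √((1 - α) * β) with hD
  have hD0 : 0 < D := by linarith
  have hM : 0 < m ^ (1 - α) := Real.rpow_pos_of_pos hm _
  have hma : 0 < m ^ α := Real.rpow_pos_of_pos hm _
  have hsz : √(z / β) ≤ 3 * c * m ^ (1 - α) / D := by
    rw [Real.sqrt_le_left (by positivity), div_le_iff₀ hβ0]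
    refine hz.trans ?_
    have e : m ^ (2 - α) ≤ (m ^ (1 - α)) ^ 2 := by
      rw [← Real.rpow_natCast, ← Real.rpow_mul hm.le]
      exact Real.rpow_le_rpow_of_exponent_ge hm hm1 (by push_cast; linarith)
    rw [div_pow, hD2]
    calc 8 * c ^ 2 / (1 - α) * m ^ (2 - α) ≤ 9 * c ^ 2 / (1 - α) * (m ^ (1 - α)) ^ 2 := by
          gcongr
          norm_num
      _ = _ := by field_simp; ring
  have huβ : u / β ≤ c * m ^ (1 - α) / D := by
    rw [div_le_iff₀ hβ0]
    refine hu.trans ?_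
    have e : c * m ^ (1 - α) / D * β = D / (1 - α) * (c * m ^ (1 - α)) := by
      rw [show β = D ^ 2 / (1 - α) by rw [hD2]; field_simp]
      field_simp
    rw [e]
    calc 8 * c / (1 - α) * m ^ (1 - α) = 8 / (1 - α) * (c * m ^ (1 - α)) := by ring
      _ ≤ _ := by
        gcongr
        linarith
  have hsum : 2 * √(z / β) + u / β ≤ 7 * c * m ^ (1 - α) / D := by
    calc 2 * √(z / β) + u / β ≤ 2 * (3 * c * m ^ (1 - α) / D) + c * m ^ (1 - α) / D := by linarith
      _ = _ := by ring
  have hhinv : 1 / h ≤ 2 * α / ((1 - α) * m ^ α) := by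
    refine (one_div_le_one_div_of_le (by positivity) hh).trans_eq ?_
    rw [one_div_div]
  have e2 : m ^ (1 - 2 * α) = m ^ (1 - α) / m ^ α := by
    rw [← Real.rpow_sub hm]
    congr 1
    ring
  calc 1 / h * (2 * √(z / β) + u / β) * ((1 - α) * D)
      ≤ 2 * α / ((1 - α) * m ^ α) * (7 * c * m ^ (1 - α) / D) * ((1 - α) * D) := by
        have : 0 ≤ 2 * √(z / β) + u / β := by positivity
        gcongr
    _ = _ := by
      rw [e2]
      field_simp
      norm_num

/-- The increment of the learning-rate parameter is dominated by one of the two barriers. -/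
theorem increment_le_barrier {α β β₁ c k m Δ : ℝ} (hα : α ∈ Set.Ioo (0 : ℝ) 1) (hc : 1 ≤ c)
    (hβ₁ : 64 * c ^ 2 / (1 - α) ≤ β₁) (hβ : β₁ ≤ β) (hk : 1 ≤ k) (hm : 0 < m) (hm1 : m ≤ 1)
    (hΔ : Δ * ((1 - α) * √((1 - α) * β)) ≤ 14 * α * c * m ^ (1 - 2 * α)) :
    (α ≤ 1 / 2 → Δ ≤ (1 - α) * β / 16) ∧
      (1 / 2 < α → Δ ≤ 32 * c * √k / ((1 - α) ^ 2 * √β₁) / 2 * m ^ (1 - 2 * α)) := by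
  have h0 := hα.1
  have h1 : 0 < 1 - α := by linarith [hα.2]
  have hβ10 : 0 < β₁ := lt_of_lt_of_le (by positivity) hβ₁
  have h64 : 64 * c ^ 2 ≤ (1 - α) * β := by
    have := hβ₁.trans hβ
    rw [div_le_iff₀ h1] at this
    linarith
  have hD8 : 8 * c ≤ √((1 - α) * β) := Real.le_sqrt_of_sq_le (by nlinarith)
  have hM : 0 < m ^ (1 - 2 * α) := Real.rpow_pos_of_pos hm _
  constructor
  · intro h
    have hM1 : m ^ (1 - 2 * α) ≤ 1 := Real.rpow_le_one hm.le hm1 (by linarith)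
    have hΔ2 : Δ ≤ 2 := by
      by_contra! h2
      have e1 : 14 * α * c * m ^ (1 - 2 * α) ≤ 7 * c := by
        calc 14 * α * c * m ^ (1 - 2 * α) ≤ 14 * (1 / 2) * c * 1 := by gcongr
          _ = 7 * c := by ring
      have e2 : 2 * (1 / 2 * (8 * c)) ≤ Δ * ((1 - α) * √((1 - α) * β)) := by
        gcongr
        linarith
      linarith
    nlinarith
  · intro h
    have hs : √(1 - α) * √β₁ ≤ √((1 - α) * β) := by
      rw [Real.sqrt_mul h1.le]
      gcongr
    have hs1 : 1 - α ≤ √(1 - α) := Real.le_sqrt_of_sq_le (by nlinarith)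
    have hsβ : 0 < √β₁ := Real.sqrt_pos.2 hβ10
    have hsk : 1 ≤ √k := Real.one_le_sqrt.2 hk
    have hden : 0 < (1 - α) ^ 2 * √β₁ := by positivity
    have e0 : (1 - α) ^ 2 * √β₁ ≤ (1 - α) * √((1 - α) * β) := by
      calc (1 - α) ^ 2 * √β₁ = (1 - α) * ((1 - α) * √β₁) := by ring
        _ ≤ (1 - α) * (√(1 - α) * √β₁) := by gcongr
        _ ≤ _ := by gcongr
    rcases le_or_gt Δ 0 with hneg | hpos
    · exact hneg.trans (by positivity)
    have e1 : Δ * ((1 - α) ^ 2 * √β₁) ≤ 16 * c * √k * m ^ (1 - 2 * α) := by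
      calc Δ * ((1 - α) ^ 2 * √β₁) ≤ Δ * ((1 - α) * √((1 - α) * β)) := by gcongr
        _ ≤ 14 * α * c * m ^ (1 - 2 * α) := hΔ
        _ ≤ 16 * 1 * c * m ^ (1 - 2 * α) := by
          gcongr
          · norm_num
          · exact hα.2.le
        _ ≤ 16 * c * √k * m ^ (1 - 2 * α) := by
          refine mul_le_mul_of_nonneg_right ?_ hM.le
          nlinarith
    rw [← le_div_iff₀ hden] at e1
    refine e1.trans_eq ?_
    ring

/-- Optimality conditions before and after an update limit the growth of a coordinate. -/
theorem entry_le_of_kkt {k : ℕ} {α β Δ b B : ℝ} {q r L l : Fin k → ℝ} (hα : α ∈ Set.Ioo (0 : ℝ) 1)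
    (hβ : 0 ≤ β) (hΔ : 0 ≤ Δ) (hb : 0 ≤ b) (hq : q ∈ stdSimplex ℝ (Fin k))
    (hr : r ∈ stdSimplex ℝ (Fin k)) (hq0 : ∀ i, 0 < q i) (hr0 : ∀ i, 0 < r i)
    (hkq : ∀ i j, L i - β * q i ^ (α - 1) - b * q i ^ (-α) =
      L j - β * q j ^ (α - 1) - b * q j ^ (-α))
    (hkr : ∀ i j, L i + l i - (β + Δ) * r i ^ (α - 1) - b * r i ^ (-α) =
      L j + l j - (β + Δ) * r j ^ (α - 1) - b * r j ^ (-α))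
    (hl : ∀ i, |l i| ≤ B) {i : Fin k}
    (hi : (β + Δ) * (4 * q i) ^ (α - 1) + b * (4 * q i) ^ (-α) <
      β * q i ^ (α - 1) + b * q i ^ (-α) - 2 * B) : r i ≤ 4 * q i := by
  have h1 : α - 1 ≤ 0 := by linarith [hα.2]
  have h2 : -α ≤ 0 := by linarith [hα.1]
  by_contra! hlt
  obtain ⟨j, -, hj⟩ : ∃ j ∈ Finset.univ, r j ≤ q j :=
    Finset.exists_le_of_sum_le ⟨i, Finset.mem_univ i⟩ (by rw [hq.2, hr.2])
  have hj1 : q j ^ (α - 1) ≤ r j ^ (α - 1) := Real.rpow_le_rpow_of_nonpos (hr0 j) hj h1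
  have hj2 : q j ^ (-α) ≤ r j ^ (-α) := Real.rpow_le_rpow_of_nonpos (hr0 j) hj h2
  have hi4 : 0 < 4 * q i := by linarith [hq0 i]
  have hi1 : r i ^ (α - 1) ≤ (4 * q i) ^ (α - 1) := Real.rpow_le_rpow_of_nonpos hi4 hlt.le h1
  have hi2 : r i ^ (-α) ≤ (4 * q i) ^ (-α) := Real.rpow_le_rpow_of_nonpos hi4 hlt.le h2
  have m1 := mul_le_mul_of_nonneg_left hj1 hβ
  have m2 := mul_le_mul_of_nonneg_left hj2 hb
  have m3 := mul_le_mul_of_nonneg_left hi1 (add_nonneg hβ hΔ)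
  have m4 := mul_le_mul_of_nonneg_left hi2 hb
  have m5 := mul_nonneg hΔ (Real.rpow_nonneg (hr0 j).le (α - 1))
  linarith [hkq i j, hkr i j, abs_le.1 (hl i), abs_le.1 (hl j)]

/-! ### Deterministic properties of the partial monitoring algorithm -/

namespace PMGame

variable {k : ℕ} {S : Type u} [Fintype S]

theorem one_le_gameConst (G : Fin k → S → Fin k → ℝ) : 1 ≤ gameConst G := le_max_left _ _

theorem abs_apply_le_norm (G : Fin k → S → Fin k → ℝ) (a : Fin k) (σ : S) (b : Fin k) :
    |G a σ b| ≤ ‖G‖ :=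
  (norm_le_pi_norm (G a σ) b).trans ((norm_le_pi_norm (G a) σ).trans (norm_le_pi_norm G a))

variable {G : Fin k → S → Fin k → ℝ} {I : (Fin k → ℝ) → Fin k} {α β₁ : ℝ}

section OneRound

variable {q : Fin k → ℝ} {β : ℝ}

theorem z_nonneg (hα : α ∈ Set.Ioo (0 : ℝ) 1) (hq : q ∈ stdSimplex ℝ (Fin k)) :
    0 ≤ (pmAlg G I α β₁).z q := by
  have h1 : 0 < 1 - α := by linarith [hα.2]
  have hs : 0 ≤ ∑ i ∈ Finset.univ.erase (I q), q i ^ (2 - α) :=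
    Finset.sum_nonneg fun i _ => Real.rpow_nonneg (hq.1 i) _
  have hm : 0 ≤ qStar I q ^ (2 - α) := Real.rpow_nonneg (min_nonneg_of_mem hq) _
  exact mul_nonneg (by positivity) (add_nonneg hs hm)

theorem u_nonneg (hα : α ∈ Set.Ioo (0 : ℝ) 1) (hq : q ∈ stdSimplex ℝ (Fin k)) :
    0 ≤ (pmAlg G I α β₁).u q := by
  have h1 : 0 < 1 - α := by linarith [hα.2]
  have hc := one_le_gameConst G
  have hm : 0 ≤ qStar I q ^ (1 - α) := Real.rpow_nonneg (min_nonneg_of_mem hq) _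
  exact mul_nonneg (by positivity) hm

theorem rate_nonneg (hα : α ∈ Set.Ioo (0 : ℝ) 1) (hβ : 0 ≤ β) (hq : q ∈ stdSimplex ℝ (Fin k)) :
    0 ≤ (pmAlg G I α β₁).rate q β :=
  add_nonneg (Real.sqrt_nonneg _) (div_nonneg (u_nonneg hα hq) hβ)

/-- The exploration components and the entropy in terms of the effective mass. -/
theorem exists_mass_bounds (hα : α ∈ Set.Ioo (0 : ℝ) 1) (hI : ∀ (q : Fin k → ℝ) i, q i ≤ q (I q))
    (hq : q ∈ stdSimplex ℝ (Fin k)) (hq0 : ∀ i, 0 < q i) :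
    ∃ m : ℝ, 0 ≤ m ∧ m ≤ 1 ∧ qStar I q ≤ m ∧
      (pmAlg G I α β₁).z q ≤ 8 * gameConst G ^ 2 / (1 - α) * m ^ (2 - α) ∧
      (pmAlg G I α β₁).u q ≤ 8 * gameConst G / (1 - α) * m ^ (1 - α) ∧
      (1 - α) * m ^ α / (2 * α) ≤ tsallis α q ∧
      tsallis α q ≤ (k : ℝ) ^ (1 - α) * m ^ α / α ∧
      ∀ a, m ≤ 2 * (1 - q a) := by
  have h1 : 0 < 1 - α := by linarith [hα.2]
  have hc := one_le_gameConst G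
  obtain ⟨m, hm0, hm1, hmin, hS, hl, hu, ha⟩ := exists_effective_mass hα hq hq0 (hI q)
  refine ⟨m, hm0, hm1, hmin, ?_, ?_, hl, hu, ha⟩
  · calc (pmAlg G I α β₁).z q ≤ 4 * gameConst G ^ 2 / (1 - α) * (2 * m ^ (2 - α)) :=
          mul_le_mul_of_nonneg_left hS (by positivity)
      _ = _ := by ring
  · exact mul_le_mul_of_nonneg_left (Real.rpow_le_rpow (min_nonneg_of_mem hq) hmin h1.le)
      (by positivity)

theorem rate_le_half (hα : α ∈ Set.Ioo (0 : ℝ) 1) (hI : ∀ (q : Fin k → ℝ) i, q i ≤ q (I q))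
    (hβ : 64 * gameConst G ^ 2 / (1 - α) ≤ β) (hq : q ∈ stdSimplex ℝ (Fin k))
    (hq0 : ∀ i, 0 < q i) : (pmAlg G I α β₁).rate q β ≤ 1 / 2 := by
  have h1 : 0 < 1 - α := by linarith [hα.2]
  have hc := one_le_gameConst G
  have hβ0 : 0 < β := lt_of_lt_of_le (by positivity) hβ
  obtain ⟨m, hm0, hm1, -, hz, hu, -, -, -⟩ :=
    exists_mass_bounds (G := G) (β₁ := β₁) hα hI hq hq0
  have hz' : (pmAlg G I α β₁).z q ≤ 8 * gameConst G ^ 2 / (1 - α) :=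
    hz.trans (mul_le_of_le_one_right (by positivity)
      (Real.rpow_le_one hm0 hm1 (by linarith)))
  have hu' : (pmAlg G I α β₁).u q ≤ 8 * gameConst G ^ 2 / (1 - α) := by
    refine hu.trans ((mul_le_of_le_one_right (by positivity)
      (Real.rpow_le_one hm0 hm1 h1.le)).trans ?_)
    gcongr
    nlinarith
  have e : 64 * gameConst G ^ 2 / (1 - α) = 8 * (8 * gameConst G ^ 2 / (1 - α)) := by ring
  have h2 : √((pmAlg G I α β₁).z q / β) ≤ 3 / 8 := by
    rw [Real.sqrt_le_left (by norm_num), div_le_iff₀ hβ0]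
    linarith
  have h3 : (pmAlg G I α β₁).u q / β ≤ 1 / 8 := by
    rw [div_le_iff₀ hβ0]
    linarith
  unfold SPB.rate SPB.rate'
  linarith

theorem mix_mem [NeZero k] (hq : q ∈ stdSimplex ℝ (Fin k)) (h0 : 0 ≤ (pmAlg G I α β₁).rate q β)
    (h1 : (pmAlg G I α β₁).rate q β ≤ 1 / 2) :
    (pmAlg G I α β₁).mix q β ∈ stdSimplex ℝ (Fin k) := by
  have hk : (k : ℝ) ≠ 0 := Nat.cast_ne_zero.2 (NeZero.ne k)
  refine ⟨fun i => ?_, ?_⟩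
  · have h2 : (0 : ℝ) ≤ 1 / k := by positivity
    exact add_nonneg (mul_nonneg (by linarith) (hq.1 i)) (mul_nonneg h0 h2)
  · unfold SPB.mix
    rw [Finset.sum_add_distrib, ← Finset.mul_sum, ← Finset.mul_sum, hq.2]
    simp [pmAlg, hk]

theorem mix_pos (hq0 : ∀ i, 0 < q i) (h0 : 0 ≤ (pmAlg G I α β₁).rate q β)
    (h1 : (pmAlg G I α β₁).rate q β ≤ 1 / 2) (i : Fin k) : 0 < (pmAlg G I α β₁).mix q β i := by
  have h2 : (0 : ℝ) ≤ 1 / k := by positivity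
  exact add_pos_of_pos_of_nonneg (mul_pos (by linarith) (hq0 i)) (mul_nonneg h0 h2)

theorem rate_le_mul_mix (hq : q ∈ stdSimplex ℝ (Fin k))
    (h1 : (pmAlg G I α β₁).rate q β ≤ 1 / 2) (i : Fin k) :
    (pmAlg G I α β₁).rate q β ≤ k * (pmAlg G I α β₁).mix q β i := by
  have hk : (0 : ℝ) < k := by
    have := Fin.pos i
    exact_mod_cast this
  have h3 : 0 ≤ (1 - (pmAlg G I α β₁).rate q β) * q i := mul_nonneg (by linarith) (hq.1 i)
  have e : k * (pmAlg G I α β₁).mix q β i = k * ((1 - (pmAlg G I α β₁).rate q β) * q i)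
      + (pmAlg G I α β₁).rate q β := by
    simp only [SPB.mix, pmAlg]
    field_simp
  rw [e]
  linarith [mul_nonneg hk.le h3]

theorem abs_est_mul_qStar_le (hα : α ∈ Set.Ioo (0 : ℝ) 1) (hβ : 0 < β)
    (hq : q ∈ stdSimplex ℝ (Fin k)) (hq0 : ∀ i, 0 < q i)
    (h1 : (pmAlg G I α β₁).rate q β ≤ 1 / 2) (a : Fin k) :
    ‖G‖ / (pmAlg G I α β₁).mix q β a * qStar I q ^ (1 - α) ≤ (1 - α) * β / 8 := by
  have h1' : 0 < 1 - α := by linarith [hα.2]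
  have hc := one_le_gameConst G
  have hmix := mix_pos hq0 (rate_nonneg (β₁ := β₁) (G := G) (I := I) hα hβ.le hq) h1 a
  have hr := rate_le_mul_mix hq h1 a
  have hN : 0 ≤ ‖G‖ := norm_nonneg G
  have hu : (pmAlg G I α β₁).u q / β ≤ k * (pmAlg G I α β₁).mix q β a :=
    le_trans (le_add_of_nonneg_left (Real.sqrt_nonneg _)) hr
  have hkG : k * ‖G‖ ≤ gameConst G := le_max_right _ _
  rw [div_le_iff₀ hβ] at hu
  change 8 * gameConst G / (1 - α) * qStar I q ^ (1 - α) ≤ _ at hu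
  rw [div_mul_eq_mul_div, div_le_iff₀ hmix]
  rw [div_mul_eq_mul_div, div_le_iff₀ h1'] at hu
  have hN' := mul_le_mul_of_nonneg_left hu hN
  have hfin : gameConst G * (8 * (‖G‖ * qStar I q ^ (1 - α))) ≤
      gameConst G * ((pmAlg G I α β₁).mix q β a * β * (1 - α)) := by
    calc _ = ‖G‖ * (8 * gameConst G * qStar I q ^ (1 - α)) := by ring
      _ ≤ ‖G‖ * (k * (pmAlg G I α β₁).mix q β a * β * (1 - α)) := hN'
      _ = k * ‖G‖ * ((pmAlg G I α β₁).mix q β a * β * (1 - α)) := by ring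
      _ ≤ _ := by gcongr
  have := le_of_mul_le_mul_left hfin (by linarith)
  linarith

theorem abs_est_le {p : Fin k → ℝ} (hp : ∀ i, 0 < p i) (a : Fin k) (σ : S) (i : Fin k) :
    |(pmAlg G I α β₁).est p a σ i| ≤ ‖G‖ / p a := by
  change |G a σ i / p a| ≤ _
  rw [abs_div, abs_of_pos (hp a)]
  exact div_le_div_of_nonneg_right (abs_apply_le_norm G a σ i) (hp a).le

/-- The pointwise bound on the stability term if the action is `a`. -/
theorem stability_le (hα : α ∈ Set.Ioo (0 : ℝ) 1) (hI : ∀ (q : Fin k → ℝ) i, q i ≤ q (I q))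
    (hβ : 0 < β) (hq : q ∈ stdSimplex ℝ (Fin k)) (hq0 : ∀ i, 0 < q i)
    (h1 : (pmAlg G I α β₁).rate q β ≤ 1 / 2) {r : Fin k → ℝ} (hr : r ∈ stdSimplex ℝ (Fin k))
    (a : Fin k) (σ : S) :
    ∑ i, (pmAlg G I α β₁).est ((pmAlg G I α β₁).mix q β) a σ i * (q i - r i)
        - β * bregman (fun p => -tsallis α p) r q ≤
      (pmAlg G I α β₁).z q / (gameConst G ^ 2 * β)
        * (‖G‖ / (pmAlg G I α β₁).mix q β a) ^ 2 := by
  have h1' : 0 < 1 - α := by linarith [hα.2]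
  have hc := one_le_gameConst G
  have hmix := mix_pos hq0 (rate_nonneg (β₁ := β₁) (G := G) (I := I) hα hβ.le hq) h1
  have hest := abs_est_le (I := I) (α := α) (β₁ := β₁) (G := G) hmix a σ
  set B := ‖G‖ / (pmAlg G I α β₁).mix q β a with hB
  have hsq : ∀ i, (pmAlg G I α β₁).est ((pmAlg G I α β₁).mix q β) a σ i ^ 2 ≤ B ^ 2 :=
    fun i => sq_le_sq' (abs_le.1 (hest i)).1 (abs_le.1 (hest i)).2
  have hm0 : 0 ≤ qStar I q := min_nonneg_of_mem hq
  refine (simplex_stability hα hβ hq hq0 (hI q) hr fun i => ?_).trans ?_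
  · exact (mul_le_mul_of_nonneg_right (hest i) (Real.rpow_nonneg hm0 _)).trans
      (abs_est_mul_qStar_le hα hβ hq hq0 h1 a)
  · have e : (pmAlg G I α β₁).z q / (gameConst G ^ 2 * β) * B ^ 2 =
        4 / (β * (1 - α)) * (∑ i ∈ Finset.univ.erase (I q), q i ^ (2 - α) * B ^ 2
          + qStar I q ^ (2 - α) * B ^ 2) := by
      rw [← Finset.sum_mul, ← add_mul]
      change 4 * gameConst G ^ 2 / (1 - α) * _ / _ * _ = _
      field_simp
    rw [e]
    refine mul_le_mul_of_nonneg_left (add_le_add (Finset.sum_le_sum fun i _ => ?_) ?_)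
      (by positivity)
    · exact mul_le_mul_of_nonneg_left (hsq i) (Real.rpow_nonneg (hq.1 i) _)
    · exact mul_le_mul_of_nonneg_left (hsq _) (Real.rpow_nonneg hm0 _)

/-- The expectation of the pointwise bound over the action. -/
theorem sum_stability_le (hα : α ∈ Set.Ioo (0 : ℝ) 1) (hβ : 0 < β)
    (hq : q ∈ stdSimplex ℝ (Fin k)) (hq0 : ∀ i, 0 < q i)
    (h1 : (pmAlg G I α β₁).rate q β ≤ 1 / 2) :
    ∑ a, (pmAlg G I α β₁).mix q β a * ((pmAlg G I α β₁).z q / (gameConst G ^ 2 * β)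
        * (‖G‖ / (pmAlg G I α β₁).mix q β a) ^ 2) ≤
      (pmAlg G I α β₁).z q / (β * (pmAlg G I α β₁).rate' q β) := by
  have hc := one_le_gameConst G
  have hz := z_nonneg (G := G) (I := I) (β₁ := β₁) hα hq
  have hmix := mix_pos hq0 (rate_nonneg (β₁ := β₁) (G := G) (I := I) hα hβ.le hq) h1
  rcases hz.eq_or_lt with hz0 | hz0
  · simp [← hz0]
  have hr' : 0 < (pmAlg G I α β₁).rate' q β := Real.sqrt_pos.2 (div_pos hz0 hβ)
  have hkG : k * ‖G‖ ≤ gameConst G := le_max_right _ _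
  have hkG2 : (k * ‖G‖) ^ 2 ≤ gameConst G ^ 2 := by gcongr
  have hterm : ∀ a, (pmAlg G I α β₁).mix q β a * ((pmAlg G I α β₁).z q / (gameConst G ^ 2 * β)
        * (‖G‖ / (pmAlg G I α β₁).mix q β a) ^ 2) ≤
      (pmAlg G I α β₁).z q / (gameConst G ^ 2 * β) * ‖G‖ ^ 2 *
        (k / (pmAlg G I α β₁).rate' q β) := by
    intro a
    have hm := hmix a
    have hinv : 1 / (pmAlg G I α β₁).mix q β a ≤ k / (pmAlg G I α β₁).rate' q β := by
      rw [div_le_div_iff₀ hm hr', one_mul]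
      exact le_trans (le_add_of_nonneg_right (div_nonneg (u_nonneg hα hq) hβ.le))
        (rate_le_mul_mix hq h1 a)
    calc _ = (pmAlg G I α β₁).z q / (gameConst G ^ 2 * β) * ‖G‖ ^ 2 *
          (1 / (pmAlg G I α β₁).mix q β a) := by field_simp
      _ ≤ _ := mul_le_mul_of_nonneg_left hinv (by positivity)
  refine (Finset.sum_le_sum fun a _ => hterm a).trans ?_
  rw [Finset.sum_const, Finset.card_univ, Fintype.card_fin, nsmul_eq_mul]
  calc _ = (pmAlg G I α β₁).z q / (β * (pmAlg G I α β₁).rate' q β) *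
        ((k * ‖G‖) ^ 2 / gameConst G ^ 2) := by field_simp
    _ ≤ (pmAlg G I α β₁).z q / (β * (pmAlg G I α β₁).rate' q β) * 1 := by
      gcongr
      exact div_le_one_of_le₀ hkG2 (by positivity)
    _ = _ := mul_one _

end OneRound

end PMGame

namespace PMGame

variable {k : ℕ} {S : Type u} [Fintype S] {G : Fin k → S → Fin k → ℝ} {I : (Fin k → ℝ) → Fin k}
  {α β₁ : ℝ}

section OneRound

variable {q : Fin k → ℝ}

theorem sqrt_z_mul_entropy_le (hα : α ∈ Set.Ioo (0 : ℝ) 1)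
    (hI : ∀ (q : Fin k → ℝ) i, q i ≤ q (I q)) (hq : q ∈ stdSimplex ℝ (Fin k))
    (hq0 : ∀ i, 0 < q i) (a : Fin k) :
    √((pmAlg G I α β₁).z q * tsallis α q) ≤
      √(32 * (gameConst G ^ 2 * (k : ℝ) ^ (1 - α) / (α * (1 - α)))) * (1 - q a) := by
  have h0 := hα.1
  have h1 : 0 < 1 - α := by linarith [hα.2]
  have ha : 0 ≤ 1 - q a := by linarith [entry_le_one hq a]
  obtain ⟨m, hm0, -, -, hz, -, -, hh, hma⟩ := exists_mass_bounds (G := G) (β₁ := β₁) hα hI hq hq0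
  rw [← Real.sqrt_sq ha, ← Real.sqrt_mul (by positivity)]
  refine Real.sqrt_le_sqrt ?_
  have e : m ^ (2 - α) * m ^ α = m ^ 2 := by
    rw [← Real.rpow_add' hm0 (by norm_num)]
    norm_num
  calc (pmAlg G I α β₁).z q * tsallis α q
      ≤ 8 * gameConst G ^ 2 / (1 - α) * m ^ (2 - α) * ((k : ℝ) ^ (1 - α) * m ^ α / α) :=
        mul_le_mul hz hh (tsallis_nonneg hα hq) (by positivity)
    _ = 8 * (gameConst G ^ 2 * (k : ℝ) ^ (1 - α) / (α * (1 - α))) * m ^ 2 := by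
        rw [← e]
        field_simp
    _ ≤ 8 * (gameConst G ^ 2 * (k : ℝ) ^ (1 - α) / (α * (1 - α))) * (2 * (1 - q a)) ^ 2 := by
        gcongr
        exact hma a
    _ = _ := by ring

theorem u_mul_entropy_le (hα : α ∈ Set.Ioo (0 : ℝ) 1)
    (hI : ∀ (q : Fin k → ℝ) i, q i ≤ q (I q)) (hq : q ∈ stdSimplex ℝ (Fin k))
    (hq0 : ∀ i, 0 < q i) (a : Fin k) :
    (pmAlg G I α β₁).u q * tsallis α q ≤
      32 * (gameConst G * (k : ℝ) ^ (1 - α) / (α * (1 - α))) * (1 - q a) := by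
  have h0 := hα.1
  have h1 : 0 < 1 - α := by linarith [hα.2]
  have hc := one_le_gameConst G
  have ha : 0 ≤ 1 - q a := by linarith [entry_le_one hq a]
  obtain ⟨m, hm0, -, -, -, hu, -, hh, hma⟩ := exists_mass_bounds (G := G) (β₁ := β₁) hα hI hq hq0
  have e : m ^ (1 - α) * m ^ α = m := by
    rw [← Real.rpow_add' hm0 (by norm_num)]
    norm_num
  calc (pmAlg G I α β₁).u q * tsallis α q
      ≤ 8 * gameConst G / (1 - α) * m ^ (1 - α) * ((k : ℝ) ^ (1 - α) * m ^ α / α) :=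
        mul_le_mul hu hh (tsallis_nonneg hα hq) (by positivity)
    _ = 8 * (gameConst G * (k : ℝ) ^ (1 - α) / (α * (1 - α))) * (m ^ (1 - α) * m ^ α) := by
        field_simp
    _ ≤ 8 * (gameConst G * (k : ℝ) ^ (1 - α) / (α * (1 - α))) * (2 * (1 - q a)) := by
        rw [e]
        gcongr
        exact hma a
    _ ≤ 8 * (gameConst G * (k : ℝ) ^ (1 - α) / (α * (1 - α))) * (4 * (1 - q a)) := by
        gcongr
        norm_num
    _ = _ := by ring

end OneRound

section Trajectory

variable (tr : ℕ → Fin k × S) (t : ℕ)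

theorem β_succ : (pmAlg G I α β₁).β tr (t + 1) = (pmAlg G I α β₁).β tr t +
    1 / tsallis α ((pmAlg G I α β₁).q tr t) *
      (2 * √((pmAlg G I α β₁).z ((pmAlg G I α β₁).q tr t) / (pmAlg G I α β₁).β tr t)
        + (pmAlg G I α β₁).u ((pmAlg G I α β₁).q tr t) / (pmAlg G I α β₁).β tr t) := rfl

theorem initial_pos (hα : α ∈ Set.Ioo (0 : ℝ) 1)
    (hβ₁ : 64 * gameConst G ^ 2 / (1 - α) ≤ β₁) : 0 < β₁ := by
  have h1 : 0 < 1 - α := by linarith [hα.2]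
  have hc := one_le_gameConst G
  exact lt_of_lt_of_le (by positivity) hβ₁

theorem βbar_nonneg : 0 ≤ (pmAlg G I α β₁).βbar := by
  have hc := one_le_gameConst G
  change 0 ≤ 32 * gameConst G * √k / ((1 - α) ^ 2 * √β₁)
  positivity

variable [NeZero k]

theorem q_mem (hα : α ∈ Set.Ioo (0 : ℝ) 1) :
    (pmAlg G I α β₁).q tr t ∈ stdSimplex ℝ (Fin k) :=
  ((pmAlg G I α β₁).ftrl_spec hα _ _).1

theorem q_isMinOn (hα : α ∈ Set.Ioo (0 : ℝ) 1) :
    IsMinOn ((pmAlg G I α β₁).objective ((pmAlg G I α β₁).state tr t).1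
      ((pmAlg G I α β₁).β tr t)) (stdSimplex ℝ (Fin k)) ((pmAlg G I α β₁).q tr t) :=
  ((pmAlg G I α β₁).ftrl_spec hα _ _).2

theorem increment_nonneg (hα : α ∈ Set.Ioo (0 : ℝ) 1) (hβ : 0 ≤ (pmAlg G I α β₁).β tr t) :
    0 ≤ 1 / tsallis α ((pmAlg G I α β₁).q tr t) *
      (2 * √((pmAlg G I α β₁).z ((pmAlg G I α β₁).q tr t) / (pmAlg G I α β₁).β tr t)
        + (pmAlg G I α β₁).u ((pmAlg G I α β₁).q tr t) / (pmAlg G I α β₁).β tr t) := by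
  have hu := u_nonneg (G := G) (I := I) (β₁ := β₁) hα
    (q_mem (G := G) (I := I) (β₁ := β₁) tr t hα)
  have hh := tsallis_nonneg hα (q_mem (G := G) (I := I) (β₁ := β₁) tr t hα)
  positivity

theorem le_β (hα : α ∈ Set.Ioo (0 : ℝ) 1) (hβ₁ : 0 ≤ β₁) : β₁ ≤ (pmAlg G I α β₁).β tr t := by
  induction t with
  | zero => exact le_rfl
  | succ t ih =>
    rw [β_succ]
    linarith [increment_nonneg tr t hα (hβ₁.trans ih)]

theorem β_pos (hα : α ∈ Set.Ioo (0 : ℝ) 1)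
    (hβ₁ : 64 * gameConst G ^ 2 / (1 - α) ≤ β₁) : 0 < (pmAlg G I α β₁).β tr t :=
  (initial_pos hα hβ₁).trans_le (le_β tr t hα (initial_pos hα hβ₁).le)

theorem q_pos (hα : α ∈ Set.Ioo (0 : ℝ) 1)
    (hβ₁ : 64 * gameConst G ^ 2 / (1 - α) ≤ β₁) (i : Fin k) : 0 < (pmAlg G I α β₁).q tr t i :=
  SPB.pos_of_isMinOn (alg := pmAlg G I α β₁) hα βbar_nonneg (β_pos tr t hα hβ₁)
    (q_mem tr t hα) (q_isMinOn tr t hα) i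

theorem γ_nonneg (hα : α ∈ Set.Ioo (0 : ℝ) 1)
    (hβ₁ : 64 * gameConst G ^ 2 / (1 - α) ≤ β₁) : 0 ≤ (pmAlg G I α β₁).γ tr t :=
  rate_nonneg hα (β_pos tr t hα hβ₁).le (q_mem tr t hα)

theorem γ_le_half (hα : α ∈ Set.Ioo (0 : ℝ) 1)
    (hβ₁ : 64 * gameConst G ^ 2 / (1 - α) ≤ β₁)
    (hI : ∀ (q : Fin k → ℝ) i, q i ≤ q (I q)) : (pmAlg G I α β₁).γ tr t ≤ 1 / 2 :=
  rate_le_half hα hI (hβ₁.trans (le_β tr t hα (initial_pos hα hβ₁).le)) (q_mem tr t hα)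
    (q_pos tr t hα hβ₁)

theorem p_mem (hα : α ∈ Set.Ioo (0 : ℝ) 1)
    (hβ₁ : 64 * gameConst G ^ 2 / (1 - α) ≤ β₁)
    (hI : ∀ (q : Fin k → ℝ) i, q i ≤ q (I q)) : (pmAlg G I α β₁).p tr t ∈ stdSimplex ℝ (Fin k) :=
  mix_mem (q_mem tr t hα) (γ_nonneg tr t hα hβ₁) (γ_le_half tr t hα hβ₁ hI)

theorem p_pos (hα : α ∈ Set.Ioo (0 : ℝ) 1)
    (hβ₁ : 64 * gameConst G ^ 2 / (1 - α) ≤ β₁)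
    (hI : ∀ (q : Fin k → ℝ) i, q i ≤ q (I q)) (i : Fin k) : 0 < (pmAlg G I α β₁).p tr t i :=
  mix_pos (q_pos tr t hα hβ₁) (γ_nonneg tr t hα hβ₁) (γ_le_half tr t hα hβ₁ hI) i

theorem q_succ_le (hα : α ∈ Set.Ioo (0 : ℝ) 1)
    (hβ₁ : 64 * gameConst G ^ 2 / (1 - α) ≤ β₁)
    (hI : ∀ (q : Fin k → ℝ) i, q i ≤ q (I q)) (i : Fin k) (hi : (pmAlg G I α β₁).q tr t i ≤ 1 / 2) :
    (pmAlg G I α β₁).q tr (t + 1) i ≤ 4 * (pmAlg G I α β₁).q tr t i := by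
  have hc := one_le_gameConst G
  have h1 : 0 < 1 - α := by linarith [hα.2]
  have hβ := β_pos (I := I) tr t hα hβ₁
  have hge := le_β (G := G) (I := I) tr t hα (initial_pos hα hβ₁).le
  have hq := q_mem (G := G) (I := I) (β₁ := β₁) tr t hα
  have hq0 := q_pos (I := I) tr t hα hβ₁
  have hΔ := increment_nonneg (G := G) (I := I) tr t hα hβ.le
  have hk : (1 : ℝ) ≤ k := by exact_mod_cast NeZero.one_le
  have hmin := entry_le_min_of_le_half hq (hI _) hi
  obtain ⟨m, -, hm1, hm, hz, hu, hh, -, -⟩ :=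
    exists_mass_bounds (G := G) (β₁ := β₁) hα hI hq hq0
  have him : (pmAlg G I α β₁).q tr t i ≤ m := hmin.trans hm
  have hinc := increment_le hα hc (hβ₁.trans hge)
    ((hq0 i).trans_le him) hm1 hz (u_nonneg hα hq) hu hh
  have hbar := increment_le_barrier hα hc hβ₁ hge hk
    ((hq0 i).trans_le him) hm1 hinc
  have hB := abs_est_mul_qStar_le hα hβ hq hq0 (γ_le_half tr t hα hβ₁ hI) (tr t).1
  have hp := p_pos tr t hα hβ₁ hI
  refine entry_le_of_kkt hα hβ.le hΔ βbar_nonneg hq (q_mem tr (t + 1) hα) hq0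
    (q_pos tr (t + 1) hα hβ₁)
    (SPB.kkt_of_isMinOn (alg := pmAlg G I α β₁) hα hq hq0 (q_isMinOn tr t hα))
    (SPB.kkt_of_isMinOn (alg := pmAlg G I α β₁) hα (q_mem tr (t + 1) hα)
      (q_pos tr (t + 1) hα hβ₁) (q_isMinOn tr (t + 1) hα))
    (abs_est_le hp (tr t).1 (tr t).2)
    (barrier_lt hα hβ hΔ βbar_nonneg (hq0 i) him ?_ hbar.1 hbar.2)
  refine (mul_le_mul_of_nonneg_left (Real.rpow_le_rpow (hq0 i).le hmin h1.le) ?_).trans hB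
  exact div_nonneg (norm_nonneg G) (hp _).le

theorem h_succ_le (hα : α ∈ Set.Ioo (0 : ℝ) 1)
    (hβ₁ : 64 * gameConst G ^ 2 / (1 - α) ≤ β₁)
    (hI : ∀ (q : Fin k → ℝ) i, q i ≤ q (I q)) : (pmAlg G I α β₁).h tr (t + 1) ≤ 4 * (pmAlg G I α β₁).h tr t :=
  tsallis_le_of_entry_le hα (q_mem tr t hα) (q_mem tr (t + 1) hα) (q_succ_le tr t hα hβ₁ hI)

end Trajectory

end PMGame

/-! ### Measurability along trajectories -/

section Prefix

variable {Ω : Type v} {k : ℕ} {O : Type u} {A : ℕ → Ω → Fin k} {o : ℕ → Ω → O} {t : ℕ}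

theorem measurable_trajectory_apply {s : ℕ} (hs : s < t) :
    Measurable[obsSigma A o t, ⊤] fun ω => trajectory A o ω s := by
  refine Measurable.mono (comap_measurable _) ?_ le_rfl
  exact le_iSup₂_of_le s (Finset.mem_range.2 hs) le_rfl

/-- A function of the first `t` actions and observations and of a further finite-valued variable is
measurable and bounded. -/
theorem stronglyMeasurable_and_bounded_of_prefix [Finite O] {Z : Type*} [Finite Z]
    [MeasurableSpace Z] [DiscreteMeasurableSpace Z] {m : MeasurableSpace Ω}
    (hm : obsSigma A o t ≤ m) {y : Ω → Z} (hy : Measurable[m] y) {F : (ℕ → Fin k × O) → Z → ℝ}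
    (hF : ∀ tr tr' : ℕ → Fin k × O, (∀ s < t, tr s = tr' s) → F tr = F tr') :
    StronglyMeasurable[m] (fun ω => F (trajectory A o ω) (y ω)) ∧
      ∃ C, ∀ ω, ‖F (trajectory A o ω) (y ω)‖ ≤ C := by
  rcases isEmpty_or_nonempty Ω with hΩ | ⟨⟨ω₀⟩⟩
  · exact ⟨(measurable_of_empty _).stronglyMeasurable, 0, fun ω => hΩ.elim ω⟩
  let _ : MeasurableSpace (Fin k × O) := ⊤
  have : DiscreteMeasurableSpace (Fin k × O) := ⟨fun _ => trivial⟩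
  let Y : Ω → (Fin t → Fin k × O) × Z := fun ω => (fun s => trajectory A o ω s, y ω)
  let F' : (Fin t → Fin k × O) × Z → ℝ := fun g =>
    F (fun s => if h : s < t then g.1 ⟨s, h⟩ else trajectory A o ω₀ 0) g.2
  have hY : Measurable[m] Y :=
    Measurable.prodMk (measurable_pi_lambda _ fun s =>
      (measurable_trajectory_apply s.2).mono hm le_rfl) hy
  have e : (fun ω => F (trajectory A o ω) (y ω)) = F' ∘ Y := by
    funext ω
    refine congrFun (hF _ _ fun s hs => ?_) _
    simp [Y, hs]
  constructor
  · rw [e]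
    exact ((measurable_of_countable F').comp hY).stronglyMeasurable
  · obtain ⟨C, hC⟩ := (Set.finite_range fun g => ‖F' g‖).bddAbove
    refine ⟨C, fun ω => ?_⟩
    rw [show F (trajectory A o ω) (y ω) = F' (Y ω) from congrFun e ω]
    exact hC ⟨Y ω, rfl⟩

theorem integrable_of_prefix [Finite O] {mΩ : MeasurableSpace Ω} {μ : Measure Ω}
    [IsFiniteMeasure μ] {Z : Type*} [Finite Z] [MeasurableSpace Z] [DiscreteMeasurableSpace Z]
    (hm : obsSigma A o t ≤ mΩ) {y : Ω → Z} (hy : Measurable y) {F : (ℕ → Fin k × O) → Z → ℝ}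
    (hF : ∀ tr tr' : ℕ → Fin k × O, (∀ s < t, tr s = tr' s) → F tr = F tr') :
    Integrable (fun ω => F (trajectory A o ω) (y ω)) μ := by
  obtain ⟨h, C, hC⟩ := stronglyMeasurable_and_bounded_of_prefix hm hy hF
  exact Integrable.of_bound h.aestronglyMeasurable C (Filter.Eventually.of_forall hC)

end Prefix

namespace SPB

variable {k : ℕ} {O : Type u} (alg : SPB k O) {tr tr' : ℕ → Fin k × O} {t : ℕ}

theorem state_congr (h : ∀ s < t, tr s = tr' s) : alg.state tr t = alg.state tr' t := by
  induction t with
  | zero => rfl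
  | succ t ih =>
    simp only [state, ih fun s hs => h s (hs.trans t.lt_succ_self), h t t.lt_succ_self]

theorem β_congr (h : ∀ s < t, tr s = tr' s) : alg.β tr t = alg.β tr' t := by
  rw [β, state_congr alg h, β]

theorem q_congr (h : ∀ s < t, tr s = tr' s) : alg.q tr t = alg.q tr' t := by
  rw [q, state_congr alg h, q]

theorem γ_congr (h : ∀ s < t, tr s = tr' s) : alg.γ tr t = alg.γ tr' t := by
  rw [γ, q_congr alg h, β_congr alg h, γ]

theorem p_congr (h : ∀ s < t, tr s = tr' s) : alg.p tr t = alg.p tr' t := by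
  rw [p, q_congr alg h, β_congr alg h, p]

theorem lossEst_congr (h : ∀ s < t + 1, tr s = tr' s) : alg.lossEst tr t = alg.lossEst tr' t := by
  rw [lossEst, p_congr alg fun s hs => h s (hs.trans t.lt_succ_self), h t t.lt_succ_self, lossEst]

end SPB

/-! ### Path sums in the tree -/

namespace PMGame

variable {k d : ℕ} {S : Type u} {𝒢 : PMGame k d S}

theorem sum_pathSum (𝒯 : 𝒢.InTree) {w : Fin k → Fin k → Fin k → S → ℝ}
    (hw : ∀ a b, 𝒢.Neighbors a b → 𝒢.EstimatesDiff a b (w a b)) (x : Fin d) (b : Fin k) :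
    ∑ a, pathSum 𝒯 w a (𝒢.feedback a x) b = 𝒢.loss b x - 𝒢.loss 𝒯.root x := by
  unfold pathSum
  rw [Finset.sum_comm]
  have hroot : 𝒯.parent^[𝒯.depth b] b = 𝒯.root := Nat.find_spec (𝒯.reaches_root b)
  calc _ = ∑ i ∈ Finset.range (𝒯.depth b),
        (𝒢.loss (𝒯.parent^[i] b) x - 𝒢.loss (𝒯.parent^[i + 1] b) x) := by
        refine Finset.sum_congr rfl fun i hi => ?_
        have hne : 𝒯.parent^[i] b ≠ 𝒯.root :=
          Nat.find_min (𝒯.reaches_root b) (Finset.mem_range.1 hi)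
        have hn := 𝒯.neighbors _ hne
        rw [← Function.iterate_succ_apply' 𝒯.parent i b] at hn
        exact hw _ _ hn x
    _ = _ := by
        rw [Finset.sum_range_sub' fun i => 𝒢.loss (𝒯.parent^[i] b) x, hroot]
        rfl

/-- The conditional expectation of the regret bound given the outcome. -/
theorem expected_gap_nonneg {g : Fin k → Fin k → ℝ} {l q p : Fin k → ℝ} {γ l₀ : ℝ} {a₀ : Fin k}
    (hg : ∀ i, ∑ a, g a i = l i - l₀) (hl : ∀ i, l i ∈ Set.Icc (0 : ℝ) 1)
    (hq : q ∈ stdSimplex ℝ (Fin k)) (hp : p ∈ stdSimplex ℝ (Fin k)) (hp0 : ∀ i, 0 < p i)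
    (hγ : 0 ≤ γ) (hpq : ∀ i, p i = (1 - γ) * q i + γ * (1 / k)) :
    0 ≤ ∑ a, (∑ i, g a i / p a * (q i - (Pi.single a₀ 1 : Fin k → ℝ) i) + 2 * γ - l a + l a₀)
      * p a := by
  have hk : (0 : ℝ) < k := by exact_mod_cast Fin.pos a₀
  have e1 : ∑ a, (∑ i, g a i / p a * (q i - (Pi.single a₀ 1 : Fin k → ℝ) i)) * p a
      = ∑ i, l i * q i - l a₀ := by
    calc _ = ∑ a, ∑ i, g a i * (q i - (Pi.single a₀ 1 : Fin k → ℝ) i) := by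
          refine Finset.sum_congr rfl fun a _ => ?_
          rw [Finset.sum_mul]
          refine Finset.sum_congr rfl fun i _ => ?_
          have := (hp0 a).ne'
          field_simp
      _ = ∑ i, (l i - l₀) * (q i - (Pi.single a₀ 1 : Fin k → ℝ) i) := by
          rw [Finset.sum_comm]
          exact Finset.sum_congr rfl fun i _ => by rw [← Finset.sum_mul, hg]
      _ = _ := by
          simp only [sub_mul, mul_sub, Finset.sum_sub_distrib, ← Finset.mul_sum, hq.2]
          simp [Pi.single_apply]
  have e2 : ∑ a, l a * p a ≤ ∑ i, l i * q i + γ := by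
    calc ∑ a, l a * p a = (1 - γ) * ∑ a, l a * q a + γ * (1 / k) * ∑ a, l a := by
          rw [Finset.mul_sum, Finset.mul_sum, ← Finset.sum_add_distrib]
          exact Finset.sum_congr rfl fun a _ => by rw [hpq]; ring
      _ ≤ ∑ a, l a * q a + γ * (1 / k) * k := by
          have h1 : 0 ≤ ∑ a, l a * q a :=
            Finset.sum_nonneg fun a _ => mul_nonneg (hl a).1 (hq.1 a)
          have h2 : ∑ a, l a ≤ k := by
            calc ∑ a, l a ≤ ∑ _a : Fin k, (1 : ℝ) := Finset.sum_le_sum fun a _ => (hl a).2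
              _ = k := by simp
          have h3 : γ * (1 / k) * ∑ a, l a ≤ γ * (1 / k) * k :=
            mul_le_mul_of_nonneg_left h2 (by positivity)
          nlinarith [mul_nonneg hγ h1]
      _ = _ := by field_simp
  simp only [add_mul, sub_mul, Finset.sum_add_distrib, Finset.sum_sub_distrib, e1, ← Finset.mul_sum,
    hp.2]
  linarith

/-! ### Interaction with the environment -/

section Interaction

variable {Ω : Type v} [mΩ : MeasurableSpace Ω] {alg : SPB k S} {μ : Measure Ω}
  {𝓕 : Filtration ℕ mΩ} {x : ℕ → Ω → Fin d} {A : ℕ → Ω → Fin k}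

theorem IsInteraction.obsSigma_le (h : 𝒢.IsInteraction alg μ 𝓕 x A) (t : ℕ) :
    obsSigma A (𝒢.obsSeq x A) t ≤ 𝓕 t := by
  refine iSup₂_le fun s hs => ?_
  have hs' : s + 1 ≤ t := Finset.mem_range.1 hs
  have hA : Measurable[𝓕 t] (A s) := (h.measurable_action s).mono (𝓕.mono hs') le_rfl
  have hx : Measurable[𝓕 t] (x s) :=
    (h.measurable_outcome s).mono (𝓕.mono (s.le_succ.trans hs')) le_rfl
  rw [← measurable_iff_comap_le]
  let _ : MeasurableSpace (Fin k × S) := ⊤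
  have hf : Measurable fun y : Fin k × Fin d => (y.1, 𝒢.feedback y.1 y.2) :=
    measurable_of_countable _
  exact hf.comp (Measurable.prodMk hA hx)

/-- Averaging over the action of the current round. -/
theorem IsInteraction.condExp_action [IsFiniteMeasure μ] (h : 𝒢.IsInteraction alg μ 𝓕 x A) (t : ℕ)
    {f : Fin k → Ω → ℝ} (hf : ∀ a, StronglyMeasurable[𝓕 t] (f a))
    (hb : ∀ a, ∃ C, ∀ ω, ‖f a ω‖ ≤ C) :
    Integrable (fun ω => f (A t ω) ω) μ ∧ μ[fun ω => f (A t ω) ω | 𝓕 t] =ᵐ[μ]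
      fun ω => ∑ a, f a ω * alg.p (trajectory A (𝒢.obsSeq x A) ω) t a := by
  have hA : Measurable (A t) := (h.measurable_action t).mono (𝓕.le _) le_rfl
  have hind : ∀ a, Integrable ((A t ⁻¹' {a}).indicator fun _ => (1 : ℝ)) μ := fun a =>
    (integrable_const _).indicator (hA (measurableSet_singleton a))
  have hfi : ∀ a, Integrable (f a * (A t ⁻¹' {a}).indicator fun _ => (1 : ℝ)) μ := by
    intro a
    obtain ⟨C, hC⟩ := hb a
    exact (hind a).bdd_mul ((hf a).mono (𝓕.le t)).aestronglyMeasurable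
      (Filter.Eventually.of_forall hC)
  have e : (fun ω => f (A t ω) ω) = ∑ a, f a * (A t ⁻¹' {a}).indicator fun _ => (1 : ℝ) := by
    funext ω
    rw [Finset.sum_apply, Finset.sum_eq_single (A t ω)]
    · simp
    · intro a _ ha
      have : ω ∉ A t ⁻¹' {a} := fun h => ha h.symm
      simp [this]
    · simp
  refine ⟨?_, ?_⟩
  · rw [e]
    exact integrable_finsetSum' _ fun a _ => hfi a
  rw [e]
  refine (condExp_finsetSum (fun a _ => hfi a) _).trans ?_
  have hall : ∀ a, μ[f a * (A t ⁻¹' {a}).indicator fun _ => (1 : ℝ) | 𝓕 t] =ᵐ[μ]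
      fun ω => f a ω * alg.p (trajectory A (𝒢.obsSeq x A) ω) t a := fun a => by
    refine (condExp_mul_of_stronglyMeasurable_left (hf a) (hfi a) (hind a)).trans ?_
    filter_upwards [h.action_law t a] with ω hω
    simp [hω]
  filter_upwards [ae_all_iff.2 hall] with ω hω
  rw [Finset.sum_apply]
  exact Finset.sum_congr rfl fun a _ => hω a

end Interaction

end PMGame

namespace PMGame

variable {k d : ℕ} {S : Type u} [Fintype S] {𝒢 : PMGame k d S} {𝒯 : 𝒢.InTree}
  {w : Fin k → Fin k → Fin k → S → ℝ} {α β₁ : ℝ} {I : (Fin k → ℝ) → Fin k}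
  {Ω : Type v} [mΩ : MeasurableSpace Ω] {μ : Measure Ω} [IsProbabilityMeasure μ]
  {𝓕 : Filtration ℕ mΩ} {x : ℕ → Ω → Fin d} {A : ℕ → Ω → Fin k}

/-- One round of the comparison of the regret with its estimate. -/
theorem integral_gap_nonneg [NeZero k]
    (hw : ∀ a b, 𝒢.Neighbors a b → 𝒢.EstimatesDiff a b (w a b)) (hα : α ∈ Set.Ioo (0 : ℝ) 1)
    (hβ₁ : 64 * gameConst (pathSum 𝒯 w) ^ 2 / (1 - α) ≤ β₁)
    (hI : ∀ (q : Fin k → ℝ) i, q i ≤ q (I q))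
    (h : 𝒢.IsInteraction (pmAlg (pathSum 𝒯 w) I α β₁) μ 𝓕 x A) (t : ℕ) (a₀ : Fin k) :
    let alg := pmAlg (pathSum 𝒯 w) I α β₁
    let tr := trajectory A (𝒢.obsSeq x A)
    let g := fun ω => ∑ i, alg.lossEst (tr ω) t i *
        (alg.q (tr ω) t i - (Pi.single a₀ 1 : Fin k → ℝ) i) + 2 * alg.γ (tr ω) t
        - 𝒢.loss (A t ω) (x t ω) + 𝒢.loss a₀ (x t ω)
    Integrable g μ ∧ 0 ≤ ∫ ω, g ω ∂μ := by
  intro alg tr g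
  let F : Fin k → (ℕ → Fin k × S) → Fin d → ℝ := fun a tr y =>
    ∑ i, pathSum 𝒯 w a (𝒢.feedback a y) i / alg.p tr t a *
      (alg.q tr t i - (Pi.single a₀ 1 : Fin k → ℝ) i) + 2 * alg.γ tr t - 𝒢.loss a y + 𝒢.loss a₀ y
  have hF : ∀ a, StronglyMeasurable[𝓕 t] (fun ω => F a (tr ω) (x t ω)) ∧
      ∃ C, ∀ ω, ‖F a (tr ω) (x t ω)‖ ≤ C := fun a => by
    refine stronglyMeasurable_and_bounded_of_prefix (h.obsSigma_le t) (h.measurable_outcome t)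
      (F := F a) fun tr tr' htr => ?_
    simp only [F, alg.p_congr htr, alg.q_congr htr, alg.γ_congr htr]
  obtain ⟨hint, hce⟩ := h.condExp_action t (f := fun a ω => F a (tr ω) (x t ω))
    (fun a => (hF a).1) (fun a => (hF a).2)
  refine ⟨hint, ?_⟩
  change 0 ≤ ∫ ω, F (A t ω) (tr ω) (x t ω) ∂μ
  rw [← integral_condExp (𝓕.le t), integral_congr_ae hce]
  refine integral_nonneg fun ω => ?_
  exact expected_gap_nonneg (sum_pathSum 𝒯 hw (x t ω)) (fun a => 𝒢.loss_mem a _)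
    (q_mem (tr ω) t hα) (p_mem (tr ω) t hα hβ₁ hI) (p_pos (tr ω) t hα hβ₁ hI)
    (γ_nonneg (tr ω) t hα hβ₁) (fun i => rfl)

theorem stability_integrable
    (h : 𝒢.IsInteraction (pmAlg (pathSum 𝒯 w) I α β₁) μ 𝓕 x A) (t : ℕ) :
    let alg := pmAlg (pathSum 𝒯 w) I α β₁
    let tr := trajectory A (𝒢.obsSeq x A)
    Integrable (fun ω => ∑ i, alg.lossEst (tr ω) t i *
        (alg.q (tr ω) t i - alg.q (tr ω) (t + 1) i)
      - alg.β (tr ω) t * bregman (fun p => -tsallis alg.α p)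
          (alg.q (tr ω) (t + 1)) (alg.q (tr ω) t)) μ := by
  intro alg tr
  refine integrable_of_prefix (t := t + 1) ((h.obsSigma_le (t + 1)).trans (𝓕.le _))
    (measurable_const (a := ())) (F := fun tr _ => ∑ i, alg.lossEst tr t i *
        (alg.q tr t i - alg.q tr (t + 1) i)
      - alg.β tr t * bregman (fun p => -tsallis alg.α p) (alg.q tr (t + 1)) (alg.q tr t))
    fun tr tr' htr => ?_
  have htr' : ∀ s < t, tr s = tr' s := fun s hs => htr s (hs.trans t.lt_succ_self)
  simp only [alg.lossEst_congr htr, alg.q_congr htr, alg.q_congr htr', alg.β_congr htr']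

theorem condExp_stability_le [NeZero k] (hα : α ∈ Set.Ioo (0 : ℝ) 1)
    (hβ₁ : 64 * gameConst (pathSum 𝒯 w) ^ 2 / (1 - α) ≤ β₁)
    (hI : ∀ (q : Fin k → ℝ) i, q i ≤ q (I q))
    (h : 𝒢.IsInteraction (pmAlg (pathSum 𝒯 w) I α β₁) μ 𝓕 x A) (t : ℕ) :
    let alg := pmAlg (pathSum 𝒯 w) I α β₁
    let tr := trajectory A (𝒢.obsSeq x A)
    μ[fun ω => ∑ i, alg.lossEst (tr ω) t i * (alg.q (tr ω) t i - alg.q (tr ω) (t + 1) i)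
      - alg.β (tr ω) t * bregman (fun p => -tsallis alg.α p)
          (alg.q (tr ω) (t + 1)) (alg.q (tr ω) t) | obsSigma A (𝒢.obsSeq x A) t]
      ≤ᵐ[μ] fun ω => alg.z (alg.q (tr ω) t) / (alg.β (tr ω) t * alg.γ' (tr ω) t) := by
  intro alg tr
  let B : Fin k → (ℕ → Fin k × S) → ℝ := fun a tr =>
    alg.z (alg.q tr t) / (gameConst (pathSum 𝒯 w) ^ 2 * alg.β tr t)
      * (‖pathSum 𝒯 w‖ / alg.p tr t a) ^ 2
  have hB : ∀ a (tr tr' : ℕ → Fin k × S), (∀ s < t, tr s = tr' s) → B a tr = B a tr' :=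
    fun a tr tr' htr => by
      simp only [B, alg.p_congr htr, alg.q_congr htr, alg.β_congr htr]
  have hBm : ∀ a, StronglyMeasurable[𝓕 t] (fun ω => B a (tr ω)) ∧ ∃ C, ∀ ω, ‖B a (tr ω)‖ ≤ C :=
    fun a => stronglyMeasurable_and_bounded_of_prefix (h.obsSigma_le t)
      (measurable_const (a := ())) (F := fun tr _ => B a tr)
      fun tr tr' htr => funext fun _ => hB a tr tr' htr
  obtain ⟨hint, hce⟩ := h.condExp_action t (f := fun a ω => B a (tr ω))
    (fun a => (hBm a).1) (fun a => (hBm a).2)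
  let E : (ℕ → Fin k × S) → Unit → ℝ := fun tr _ => ∑ a, B a tr * alg.p tr t a
  have hE : ∀ tr tr' : ℕ → Fin k × S, (∀ s < t, tr s = tr' s) → E tr = E tr' :=
    fun tr tr' htr => funext fun _ => by
      simp only [E, hB _ tr tr' htr, alg.p_congr htr]
  have hEm := (stronglyMeasurable_and_bounded_of_prefix
    (le_refl (obsSigma A (𝒢.obsSeq x A) t)) (measurable_const (a := ())) hE).1
  have hEi : Integrable (fun ω => E (tr ω) ()) μ :=
    integrable_of_prefix ((h.obsSigma_le t).trans (𝓕.le _)) (measurable_const (a := ())) hE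
  have hmono := condExp_mono (m := obsSigma A (𝒢.obsSeq x A) t) (stability_integrable h t) hint
    (Filter.Eventually.of_forall fun ω =>
      stability_le hα hI (β_pos (tr ω) t hα hβ₁) (q_mem (tr ω) t hα)
        (q_pos (tr ω) t hα hβ₁) (γ_le_half (tr ω) t hα hβ₁ hI) (q_mem (tr ω) (t + 1) hα)
        (A t ω) (𝒢.obsSeq x A t ω))
  have htower := (condExp_condExp_of_le (μ := μ) (f := fun ω => B (A t ω) (tr ω))
    (h.obsSigma_le t) (𝓕.le t)).symm.trans
    ((condExp_congr_ae hce).trans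
      (Filter.EventuallyEq.of_eq (condExp_of_stronglyMeasurable
        ((h.obsSigma_le t).trans (𝓕.le _)) hEm hEi)))
  filter_upwards [hmono, htower] with ω h1 h2
  refine h1.trans (h2.le.trans ?_)
  have := sum_stability_le (G := pathSum 𝒯 w) (I := I) (β₁ := β₁) hα (β_pos (tr ω) t hα hβ₁)
    (q_mem (tr ω) t hα) (q_pos (tr ω) t hα hβ₁) (γ_le_half (tr ω) t hα hβ₁ hI)
  refine le_trans (le_of_eq ?_) this
  exact Finset.sum_congr rfl fun a _ => mul_comm _ _

theorem regret_integrable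
    (h : 𝒢.IsInteraction (pmAlg (pathSum 𝒯 w) I α β₁) μ 𝓕 x A) (T : ℕ) (a₀ : Fin k) :
    let alg := pmAlg (pathSum 𝒯 w) I α β₁
    let tr := trajectory A (𝒢.obsSeq x A)
    Integrable (fun ω => ∑ t ∈ Finset.range T, ∑ i, alg.lossEst (tr ω) t i *
        (alg.q (tr ω) t i - (Pi.single a₀ 1 : Fin k → ℝ) i)
      + 2 * ∑ t ∈ Finset.range T, alg.γ (tr ω) t) μ := by
  intro alg tr
  refine integrable_of_prefix (t := T) ((h.obsSigma_le T).trans (𝓕.le _))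
    (measurable_const (a := ())) (F := fun tr _ => ∑ t ∈ Finset.range T, ∑ i, alg.lossEst tr t i *
        (alg.q tr t i - (Pi.single a₀ 1 : Fin k → ℝ) i)
      + 2 * ∑ t ∈ Finset.range T, alg.γ tr t)
    fun tr tr' htr => funext fun _ => ?_
  have hle : ∀ t ∈ Finset.range T, ∀ s < t + 1, tr s = tr' s := fun t ht s hs =>
    htr s (lt_of_lt_of_le hs (Finset.mem_range.1 ht))
  have hlt : ∀ t ∈ Finset.range T, ∀ s < t, tr s = tr' s := fun t ht s hs =>
    hle t ht s (hs.trans t.lt_succ_self)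
  refine congrArg₂ _ (Finset.sum_congr rfl fun t ht => ?_)
    (congrArg _ (Finset.sum_congr rfl fun t ht => alg.γ_congr (hlt t ht)))
  simp only [alg.lossEst_congr (hle t ht), alg.q_congr (hlt t ht)]

theorem regret_le_estimate [NeZero k]
    (hw : ∀ a b, 𝒢.Neighbors a b → 𝒢.EstimatesDiff a b (w a b)) (hα : α ∈ Set.Ioo (0 : ℝ) 1)
    (hβ₁ : 64 * gameConst (pathSum 𝒯 w) ^ 2 / (1 - α) ≤ β₁)
    (hI : ∀ (q : Fin k → ℝ) i, q i ≤ q (I q))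
    (h : 𝒢.IsInteraction (pmAlg (pathSum 𝒯 w) I α β₁) μ 𝓕 x A) (T : ℕ) (a₀ : Fin k) :
    let alg := pmAlg (pathSum 𝒯 w) I α β₁
    let tr := trajectory A (𝒢.obsSeq x A)
    regret μ (𝒢.lossSeq x) A T a₀ ≤ ∫ ω, (∑ t ∈ Finset.range T, ∑ i, alg.lossEst (tr ω) t i *
        (alg.q (tr ω) t i - (Pi.single a₀ 1 : Fin k → ℝ) i)
      + 2 * ∑ t ∈ Finset.range T, alg.γ (tr ω) t) ∂μ := by
  intro alg tr
  have hgap := fun t => integral_gap_nonneg hw hα hβ₁ hI h t a₀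
  have hsum : 0 ≤ ∫ ω, ∑ t ∈ Finset.range T, (∑ i, alg.lossEst (tr ω) t i *
        (alg.q (tr ω) t i - (Pi.single a₀ 1 : Fin k → ℝ) i) + 2 * alg.γ (tr ω) t
        - 𝒢.loss (A t ω) (x t ω) + 𝒢.loss a₀ (x t ω)) ∂μ := by
    rw [integral_finsetSum _ fun t _ => (hgap t).1]
    exact Finset.sum_nonneg fun t _ => (hgap t).2
  have hsi : Integrable (fun ω => ∑ t ∈ Finset.range T, (∑ i, alg.lossEst (tr ω) t i *
        (alg.q (tr ω) t i - (Pi.single a₀ 1 : Fin k → ℝ) i) + 2 * alg.γ (tr ω) t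
        - 𝒢.loss (A t ω) (x t ω) + 𝒢.loss a₀ (x t ω))) μ :=
    integrable_finsetSum _ fun t _ => (hgap t).1
  have hreg : regret μ (𝒢.lossSeq x) A T a₀ = ∫ ω, ((∑ t ∈ Finset.range T, ∑ i,
        alg.lossEst (tr ω) t i * (alg.q (tr ω) t i - (Pi.single a₀ 1 : Fin k → ℝ) i)
      + 2 * ∑ t ∈ Finset.range T, alg.γ (tr ω) t)
      - ∑ t ∈ Finset.range T, (∑ i, alg.lossEst (tr ω) t i *
        (alg.q (tr ω) t i - (Pi.single a₀ 1 : Fin k → ℝ) i) + 2 * alg.γ (tr ω) t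
        - 𝒢.loss (A t ω) (x t ω) + 𝒢.loss a₀ (x t ω))) ∂μ := by
    unfold regret
    congr 1
    funext ω
    simp only [Finset.sum_add_distrib, Finset.sum_sub_distrib, ← Finset.mul_sum, lossSeq]
    ring
  rw [hreg, integral_sub (regret_integrable h T a₀) hsi]
  linarith

/-- The algorithm satisfies the assumptions of the best-of-both-worlds regret bound against every
action. -/
theorem bobwAssumptions [NeZero k]
    (hw : ∀ a b, 𝒢.Neighbors a b → 𝒢.EstimatesDiff a b (w a b)) (hα : α ∈ Set.Ioo (0 : ℝ) 1)
    (hβ₁ : 64 * gameConst (pathSum 𝒯 w) ^ 2 / (1 - α) ≤ β₁)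
    (hI : ∀ (q : Fin k → ℝ) i, q i ≤ q (I q))
    (h : 𝒢.IsInteraction (pmAlg (pathSum 𝒯 w) I α β₁) μ 𝓕 x A) (T : ℕ) (a₀ : Fin k) :
    BOBWAssumptions (pmAlg (pathSum 𝒯 w) I α β₁) μ (𝒢.lossSeq x) A (𝒢.obsSeq x A) T a₀ 4
      (32 * (gameConst (pathSum 𝒯 w) ^ 2 * (k : ℝ) ^ (1 - α) / (α * (1 - α))))
      (32 * (gameConst (pathSum 𝒯 w) * (k : ℝ) ^ (1 - α) / (α * (1 - α)))) where
  loss_le t _ ω a := by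
    obtain ⟨h0, h1⟩ := 𝒢.loss_mem a (x t ω)
    exact abs_le.2 ⟨by change -1 ≤ 𝒢.loss a (x t ω); linarith, h1⟩
  z_nonneg t _ ω := z_nonneg hα (q_mem _ t hα)
  u_nonneg t _ ω := u_nonneg hα (q_mem _ t hα)
  rate_mem t _ ω := ⟨γ_nonneg _ t hα hβ₁, γ_le_half _ t hα hβ₁ hI⟩
  p_mem t _ ω := p_mem _ t hα hβ₁ hI
  regret_integrable := regret_integrable h T a₀
  regret_le := regret_le_estimate hw hα hβ₁ hI h T a₀
  stability_integrable t _ := stability_integrable h t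
  stability t _ := by
    filter_upwards [condExp_stability_le hα hβ₁ hI h t] with ω hω
    refine hω.trans (le_mul_of_one_le_left ?_ (by norm_num))
    exact div_nonneg (z_nonneg hα (q_mem _ t hα))
      (mul_nonneg (β_pos _ t hα hβ₁).le (Real.sqrt_nonneg _))
  penalty t _ ω := h_succ_le _ t hα hβ₁ hI
  z_mul_h_le t _ ω := sqrt_z_mul_entropy_le hα hI (q_mem _ t hα) (q_pos _ t hα hβ₁) a₀
  u_mul_h_le t _ ω := u_mul_entropy_le hα hI (q_mem _ t hα) (q_pos _ t hα hβ₁) a₀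

end PMGame

theorem theorem5 :
    ∃ C c₁ c₂ : ℝ, 0 < C ∧ 0 < c₁ ∧ 0 < c₂ ∧
      ∀ (k d : ℕ) (S : Type u) [Fintype S] (𝒢 : PMGame k d S),
        (∀ a b, a ≠ b → 𝒢.loss a ≠ 𝒢.loss b) →
        (∀ a, 𝒢.ParetoOptimal a) →
        𝒢.GloballyObservable →
        ∀ (𝒯 : 𝒢.InTree) (w : Fin k → Fin k → Fin k → S → ℝ),
          (∀ a b, 𝒢.Neighbors a b → 𝒢.EstimatesDiff a b (w a b)) →
          ∀ α ∈ Set.Ioo (0 : ℝ) 1,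
            ∃ ρ₁ ρ₂ : ℝ, 0 < ρ₁ ∧ 0 < ρ₂ ∧
              ρ₁ ∈ Set.Icc
                (c₁ * (PMGame.gameConst (PMGame.pathSum 𝒯 w) ^ 2 * (k : ℝ) ^ (1 - α)
                  / (α * (1 - α))))
                (c₂ * (PMGame.gameConst (PMGame.pathSum 𝒯 w) ^ 2 * (k : ℝ) ^ (1 - α)
                  / (α * (1 - α)))) ∧
              ρ₂ ∈ Set.Icc
                (c₁ * (PMGame.gameConst (PMGame.pathSum 𝒯 w) * (k : ℝ) ^ (1 - α)
                  / (α * (1 - α))))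
                (c₂ * (PMGame.gameConst (PMGame.pathSum 𝒯 w) * (k : ℝ) ^ (1 - α)
                  / (α * (1 - α)))) ∧
              ∀ β₁ : ℝ, 64 * PMGame.gameConst (PMGame.pathSum 𝒯 w) ^ 2 / (1 - α) ≤ β₁ →
              ∀ I : (Fin k → ℝ) → Fin k, (∀ (q : Fin k → ℝ) i, q i ≤ q (I q)) →
              ∀ (Ω : Type v) [mΩ : MeasurableSpace Ω] (μ : Measure Ω) [IsProbabilityMeasure μ]
                (𝓕 : Filtration ℕ mΩ) (x : ℕ → Ω → Fin d) (A : ℕ → Ω → Fin k),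
                𝒢.IsInteraction (PMGame.pmAlg (PMGame.pathSum 𝒯 w) I α β₁) μ 𝓕 x A →
                ∀ (T : ℕ) (astar : Fin k), IsOptimalAction μ (𝒢.lossSeq x) T astar →
                  BOBWAssumptions (PMGame.pmAlg (PMGame.pathSum 𝒯 w) I α β₁) μ (𝒢.lossSeq x) A
                    (𝒢.obsSeq x A) T astar C ρ₁ ρ₂ := by
  refine ⟨4, 32, 32, by norm_num, by norm_num, by norm_num, ?_⟩
  intro k d S _ 𝒢 _ _ _ 𝒯 w hw α hα
  have : NeZero k := ⟨(Fin.pos 𝒯.root).ne'⟩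
  have hk : (0 : ℝ) < k := Nat.cast_pos.2 (Fin.pos 𝒯.root)
  have hc := PMGame.one_le_gameConst (PMGame.pathSum 𝒯 w)
  have h0 := hα.1
  have h1 : 0 < 1 - α := by linarith [hα.2]
  refine ⟨_, _, by positivity, by positivity, ⟨le_rfl, le_rfl⟩, ⟨le_rfl, le_rfl⟩, ?_⟩
  intro β₁ hβ₁ I hI Ω _ μ _ 𝓕 x A h T a₀ _
  exact PMGame.bobwAssumptions hw hα hβ₁ hI h T a₀
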